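/- **Theorem 3.1.** Let $\mathcal B\subseteq\mathcal A$ be a unital inclusion of unital $C^*$-algebras and let $E:\mathcal A\to\mathcal B$ be a conditional expectation, i.e. a completely positive $\mathcal B$-$\mathcal B$-bimodule map with $E|_{\mathcal B}=\mathrm{id}$. Let $\eta:\mathcal B\to\mathcal B$ be a linear map such that $\eta-\mathrm{id}$ is completely positive. Let $X,V\in\mathcal A$ with $X=X^*$, and suppose that the unital $*$-subalgebras generated by $\mathcal B\cup\{X\}$ and by $\mathcal B\cup\{V\}$ are freely independent over $\mathcal B$, i.e. $E[a_1\cdots a_k]=0$ whenever $k\ge1$, the $a_j$ lie alternately in the two subalgebras and $E[a_j]=0$ for all $j$. Suppose also that for all $b,b_1,b_2\in\mathcal B$ $$V b_1V^*b_2V=Vb_1\eta(b_2),\qquad E[VbV^*]=b .$$ Then $\tilde E[T]:=E[VTV^*]$ is again a conditional expectation $\mathcal A\to\mathcal B$, and the $\mathcal B$-valued law $\nu$ of $V^*XV$ with respect to $\tilde E$ is the free convolution power $\mu^{\boxplus\eta}$ of the $\mathcal B$-valued law $\mu$ of $X$ with respect to $E$: there is $\delta>0$, independent of $n$, such that for every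 $n$ the R-transforms $R^{(n)}_\mu$ and $R^{(n)}_\nu$ are defined on the ball $B_\delta(0)\subseteq M_n(\mathcal B)$ and $$R^{(n)}_\nu(z)=\eta^{(n)}\big(R^{(n)}_\mu(z)\big)\qquad(z\in B_\delta(0)).$$ Here $\mathcal B\langle x\rangle$ is the algebra of non-commutative polynomials with coefficients in $\mathcal B$, the law of $X$ with respect to $E$ is the map $\mathcal B\langle x\rangle\to\mathcal B$, $f\mapsto E[f(X)]$, and $\phi^{(n)}$ denotes the entrywise application of a map $\phi$ to $n\times n$ matrices. For a law $\mu$, put $\tilde G^{(n)}_\mu(z)=\sum_{k\ge0}\mu^{(n)}[z(xz)^k]$ for $z\in M_n(\mathcal B)$ near $0$, where $x$ stands for $x\otimes I_n$; if $\mu$ is the law of $X$ with respect to $E$ this is $E^{(n)}[z(1-(X\otimes I_n)z)^{-1}]$, and it equals $G^{(n)}_\mu(z^{-1})=E^{(n)}[(z^{-1}-X\otimes I_n)^{-1}]$ for invertible $z$. Let $K^{(n)}_\mu$ be its inverse function near $0$, i.e. the holomorphic function on a ball around $0$ with $K^{(n)}_\mu(0)=0$ and $\tilde G^{(n)}_\mu(K^{(n)}_\mu(z))=z$.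 The R-transform $R^{(n)}_\mu$ is the holomorphic function on a ball around $0$ with $R^{(n)}_\mu(z)=K^{(n)}_\mu(z)^{-1}-z^{-1}$ for all invertible $z$ in the ball. -/

import Mathlib

noncomputable section

namespace OperatorValued

section Expectation

variable {A B : Type*} [CStarAlgebra A] [PartialOrder A] [StarOrderedRing A]
  [CStarAlgebra B] [PartialOrder B] [StarOrderedRing B]

/-- A linear map between C⋆-algebras is completely positive if all its entrywise amplifications
to matrices are positive, that is, if it underlies a Mathlib `CompletelyPositiveMap`. -/
def IsCompletelyPositive (φ : A →ₗ[ℂ] B) : Prop :=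
  ∃ ψ : CompletelyPositiveMap A B, ψ.toLinearMap = φ

/-- `(A, E)` is a `B`-valued probability space: `ι : B → A` is a unital `*`-homomorphism (the
inclusion of `B` in `A`) and `E : A → B` is a conditional expectation. Injectivity of `ι` follows
from `apply_incl`. -/
structure IsConditionalExpectation (ι : B →⋆ₐ[ℂ] A) (E : A →ₗ[ℂ] B) : Prop where
  apply_incl : ∀ b, E (ι b) = b
  bimodule : ∀ b₁ b₂ a, E (ι b₁ * a * ι b₂) = b₁ * E a * b₂
  completelyPositive : IsCompletelyPositive E

/-- The map `T ↦ E[V T V*]`. -/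
def compress (E : A →ₗ[ℂ] B) (V : A) : A →ₗ[ℂ] B :=
  E ∘ₗ LinearMap.mulLeft ℂ V ∘ₗ LinearMap.mulRight ℂ (star V)

/-- Free independence of a family of subalgebras with respect to `E`: the expectation of every
non-empty alternating product of centred elements vanishes. -/
def FreelyIndependent {κ : Type*} (E : A →ₗ[ℂ] B) (S : κ → Subalgebra ℂ A) : Prop :=
  ∀ (k : ℕ) (i : Fin (k + 1) → κ) (a : Fin (k + 1) → A),
    (∀ j, a j ∈ S (i j)) → (∀ j, E (a j) = 0) →
    (∀ j : Fin k, i j.castSucc ≠ i j.succ) →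
    E (List.ofFn a).prod = 0

/-- The unital `*`-subalgebra of `A` generated by `B` and one element. -/
def generatedBy (ι : B →⋆ₐ[ℂ] A) (a : A) : Subalgebra ℂ A :=
  (StarAlgebra.adjoin ℂ (Set.range ι ∪ {a})).toSubalgebra

/-- Free independence over `B` of two elements: the unital `*`-subalgebras that they generate
together with `B` are freely independent. -/
def FreeOver (ι : B →⋆ₐ[ℂ] A) (E : A →ₗ[ℂ] B) (X Y : A) : Prop :=
  FreelyIndependent E ![generatedBy ι X, generatedBy ι Y]

end Expectation

section Polynomials

/-- The relations which make the generators labelled by `B` a unital copy of the algebra `B`;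
the generator labelled `none` is the indeterminate. -/
inductive NCPoly.Rel (B : Type*) [Ring B] [Algebra ℂ B] :
    FreeAlgebra ℂ (Option B) → FreeAlgebra ℂ (Option B) → Prop
  | add (b c : B) : NCPoly.Rel B (FreeAlgebra.ι ℂ (some (b + c)))
      (FreeAlgebra.ι ℂ (some b) + FreeAlgebra.ι ℂ (some c))
  | mul (b c : B) : NCPoly.Rel B (FreeAlgebra.ι ℂ (some (b * c)))
      (FreeAlgebra.ι ℂ (some b) * FreeAlgebra.ι ℂ (some c))
  | scalar (r : ℂ) : NCPoly.Rel B (FreeAlgebra.ι ℂ (some (algebraMap ℂ B r)))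
      (algebraMap ℂ (FreeAlgebra ℂ (Option B)) r)

/-- The algebra `B⟨x⟩` of non-commutative polynomials: the universal unital complex algebra
generated by the algebra `B` and one indeterminate `x`. (Its involution, determined by that of `B`
and `x* = x`, plays no role in what follows.) -/
abbrev NCPoly (B : Type*) [Ring B] [Algebra ℂ B] : Type _ := RingQuot (NCPoly.Rel B)

namespace NCPoly

variable {B : Type*} [Ring B] [Algebra ℂ B] {A : Type*} [Ring A] [Algebra ℂ A]

/-- The coefficient `b ∈ B` as an element of `B⟨x⟩`. -/
def C (b : B) : NCPoly B := RingQuot.mkAlgHom ℂ (NCPoly.Rel B) (FreeAlgebra.ι ℂ (some b))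

/-- The indeterminate `x` of `B⟨x⟩`. -/
def x : NCPoly B := RingQuot.mkAlgHom ℂ (NCPoly.Rel B) (FreeAlgebra.ι ℂ none)

/-- Evaluation `f ↦ f(X)`, for `B` mapped to `A` by `ι`. -/
def eval (ι : B →ₐ[ℂ] A) (X : A) : NCPoly B →ₐ[ℂ] A :=
  RingQuot.liftAlgHom ℂ ⟨FreeAlgebra.lift ℂ (fun o : Option B => o.elim X ι), by
    intro p q h
    cases h <;> simp⟩

@[simp] theorem eval_C (ι : B →ₐ[ℂ] A) (X : A) (b : B) : eval ι X (C b) = ι b := by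
  simp [eval, C, RingQuot.liftAlgHom_mkAlgHom_apply]

@[simp] theorem eval_x (ι : B →ₐ[ℂ] A) (X : A) : eval ι X (x : NCPoly B) = X := by
  simp [eval, x, RingQuot.liftAlgHom_mkAlgHom_apply]

end NCPoly

end Polynomials

section Laws

variable {A B : Type*} [CStarAlgebra A] [CStarAlgebra B]

/-- The `B`-valued law of `X` with respect to `E`: the map `B⟨x⟩ → B`, `f ↦ E[f(X)]`. -/
def law (ι : B →⋆ₐ[ℂ] A) (E : A →ₗ[ℂ] B) (X : A) : NCPoly B →ₗ[ℂ] B :=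
  E ∘ₗ (NCPoly.eval (ι : B →ₐ[ℂ] A) X).toLinearMap

end Laws

/-- The scalar amplification `a ⊗ Iₙ`, the diagonal matrix with all diagonal entries `a`. -/
def amp {R : Type*} [Zero R] (n : ℕ) (a : R) : CStarMatrix (Fin n) (Fin n) R :=
  CStarMatrix.ofMatrix (Matrix.diagonal fun _ => a)

section Transforms

variable {B : Type*} [CStarAlgebra B]

/-- The `k`-th term `μ⁽ⁿ⁾[z (x z)ᵏ]` of the expansion at `z = 0` of the transform
`G̃⁽ⁿ⁾(z) = G⁽ⁿ⁾(z⁻¹) = E⁽ⁿ⁾[z (1 - X⁽ⁿ⁾ z)⁻¹]` of a law `μ`; see `hasSum_gTerm_law` and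
`hasSum_gTerm_law_of_isUnit` for the resolvent form. -/
def gTerm (μ : NCPoly B →ₗ[ℂ] B) (n : ℕ) (z : CStarMatrix (Fin n) (Fin n) B) (k : ℕ) :
    CStarMatrix (Fin n) (Fin n) B :=
  (z.map NCPoly.C * (amp n NCPoly.x * z.map NCPoly.C) ^ k).map μ

variable [PartialOrder B] [StarOrderedRing B]

/-- `K` is, at every matrix level, the inverse function of `G̃` on the ball of radius `δ` around
`0`: it is the holomorphic function with `K(0) = 0` and `G̃(K(z)) = z`. -/
structure IsInverseGTransform (μ : NCPoly B →ₗ[ℂ] B) (δ : ℝ)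
    (K : ∀ n : ℕ, CStarMatrix (Fin n) (Fin n) B → CStarMatrix (Fin n) (Fin n) B) : Prop where
  differentiableOn : ∀ n, DifferentiableOn ℂ (K n) (Metric.ball 0 δ)
  map_zero : ∀ n, K n 0 = 0
  hasSum : ∀ n, ∀ z ∈ Metric.ball (0 : CStarMatrix (Fin n) (Fin n) B) δ,
    HasSum (gTerm μ n (K n z)) z

/-- `R` is the R-transform of `μ` on the ball of radius `δ` around `0`, at every matrix level: it
is holomorphic on the ball, and `R(z) = K(z)⁻¹ - z⁻¹` for invertible `z`, where `K` is the inverse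
function of `G̃`. Since the invertible elements of the ball contain a non-empty open set, `R` is
unique on the ball. -/
def IsRTransform (μ : NCPoly B →ₗ[ℂ] B) (δ : ℝ)
    (R : ∀ n : ℕ, CStarMatrix (Fin n) (Fin n) B → CStarMatrix (Fin n) (Fin n) B) : Prop :=
  (∀ n, DifferentiableOn ℂ (R n) (Metric.ball 0 δ)) ∧
  ∃ K : ∀ n : ℕ, CStarMatrix (Fin n) (Fin n) B → CStarMatrix (Fin n) (Fin n) B,
    IsInverseGTransform μ δ K ∧
    ∀ n, ∀ z ∈ Metric.ball (0 : CStarMatrix (Fin n) (Fin n) B) δ, IsUnit z →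
      IsUnit (K n z) ∧ R n z = Ring.inverse (K n z) - Ring.inverse z

/-- `ν` is the `η`-free convolution power of `μ`: on a ball around `0` of radius independent of
the matrix level, both R-transforms are defined and that of `ν` is `η`, applied entrywise, of
that of `μ`. -/
def IsFreeConvolutionPower (η : B →ₗ[ℂ] B) (μ ν : NCPoly B →ₗ[ℂ] B) : Prop :=
  ∃ δ : ℝ, 0 < δ ∧
    ∃ Rμ Rν : ∀ n : ℕ, CStarMatrix (Fin n) (Fin n) B → CStarMatrix (Fin n) (Fin n) B,
      IsRTransform μ δ Rμ ∧ IsRTransform ν δ Rν ∧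
      ∀ n, ∀ z ∈ Metric.ball (0 : CStarMatrix (Fin n) (Fin n) B) δ,
        Rν n z = (Rμ n z).map η

end Transforms

section Resolvent

variable {A B : Type*} [CStarAlgebra A] [CStarAlgebra B]

theorem gTerm_law (ι : B →⋆ₐ[ℂ] A) (E : A →ₗ[ℂ] B) (X : A) (n : ℕ)
    (z : CStarMatrix (Fin n) (Fin n) B) (k : ℕ) :
    gTerm (law ι E X) n z k = (z.map ι * (amp n X * z.map ι) ^ k).map E := by
  have key : (RingHom.mapMatrix (m := Fin n)
      (NCPoly.eval (ι : B →ₐ[ℂ] A) X : NCPoly B →+* A))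
      ((z.map NCPoly.C * (amp n NCPoly.x * z.map NCPoly.C) ^ k :
        CStarMatrix (Fin n) (Fin n) (NCPoly B)) : Matrix (Fin n) (Fin n) (NCPoly B)) =
      ((z.map ι * (amp n X * z.map ι) ^ k : CStarMatrix (Fin n) (Fin n) A) :
        Matrix (Fin n) (Fin n) A) := by
    have h1 : (RingHom.mapMatrix (m := Fin n)
      (NCPoly.eval (ι : B →ₐ[ℂ] A) X : NCPoly B →+* A))
      ((z.map NCPoly.C : CStarMatrix (Fin n) (Fin n) (NCPoly B)) :
        Matrix (Fin n) (Fin n) (NCPoly B)) = (z.map ι : CStarMatrix (Fin n) (Fin n) A) := by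
      ext i j
      exact NCPoly.eval_C _ _ _
    have h2 : (RingHom.mapMatrix (m := Fin n)
      (NCPoly.eval (ι : B →ₐ[ℂ] A) X : NCPoly B →+* A))
      ((amp n NCPoly.x : CStarMatrix (Fin n) (Fin n) (NCPoly B)) :
        Matrix (Fin n) (Fin n) (NCPoly B)) = (amp n X : CStarMatrix (Fin n) (Fin n) A) := by
      ext i j
      change NCPoly.eval (ι : B →ₐ[ℂ] A) X (Matrix.diagonal (fun _ => NCPoly.x) i j) =
        Matrix.diagonal (fun _ => X) i j
      by_cases h : i = j
      · subst h
        simp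
      · simp [h]
    refine (map_mul _ _ _).trans ?_
    rw [h1]
    refine congrArg _ ((map_pow _ _ _).trans ?_)
    refine congrArg (fun m : Matrix (Fin n) (Fin n) A => m ^ k) ((map_mul _ _ _).trans ?_)
    rw [h1, h2]
    rfl
  exact congrArg (fun m : Matrix (Fin n) (Fin n) A => m.map E) key

variable [PartialOrder A] [StarOrderedRing A] [PartialOrder B] [StarOrderedRing B]

/-- For `z` near `0`, the series of `gTerm` sums to `E⁽ⁿ⁾[z (1 - X⁽ⁿ⁾ z)⁻¹]`. -/
theorem hasSum_gTerm_law (ι : B →⋆ₐ[ℂ] A) (E : A →ₗ[ℂ] B) (hE : IsConditionalExpectation ι E)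
    (X : A) (n : ℕ) (z : CStarMatrix (Fin n) (Fin n) B) (hz : ‖amp n X * z.map ι‖ < 1) :
    HasSum (gTerm (law ι E X) n z)
      ((z.map ι * Ring.inverse (1 - amp n X * z.map ι)).map E) := by
  obtain ⟨ψ, rfl⟩ := hE.completelyPositive
  have hc : Continuous ψ.toLinearMap := map_continuous ψ
  have h := (hasSum_geom_series_inverse _ hz).mul_left (z.map ι)
  have hm : Continuous (fun M : Matrix (Fin n) (Fin n) A => M.map ψ.toLinearMap) :=
    continuous_id.matrix_map hc
  simp_rw [funext (gTerm_law ι ψ.toLinearMap X n z)]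
  exact h.map (CStarMatrix.mapₗ ψ.toLinearMap) hm

/-- For invertible `z` near `0`, the series of `gTerm` sums to the Cauchy transform
`G⁽ⁿ⁾(z⁻¹) = E⁽ⁿ⁾[(z⁻¹ - X⁽ⁿ⁾)⁻¹]`. -/
theorem hasSum_gTerm_law_of_isUnit (ι : B →⋆ₐ[ℂ] A) (E : A →ₗ[ℂ] B)
    (hE : IsConditionalExpectation ι E) (X : A) (n : ℕ)
    (z : (CStarMatrix (Fin n) (Fin n) B)ˣ)
    (hz : ‖amp n X * (z : CStarMatrix (Fin n) (Fin n) B).map ι‖ < 1) :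
    HasSum (gTerm (law ι E X) n z)
      ((Ring.inverse ((↑z⁻¹ : CStarMatrix (Fin n) (Fin n) B).map ι - amp n X)).map E) := by
  have h := hasSum_gTerm_law ι E hE X n z hz
  have hmul (p q : CStarMatrix (Fin n) (Fin n) B) : p.map ι * q.map ι = (p * q).map ι :=
    (map_mul (RingHom.mapMatrix (m := Fin n) (ι : B →+* A)) p q).symm
  have hone : (1 : CStarMatrix (Fin n) (Fin n) B).map ι = 1 :=
    map_one (RingHom.mapMatrix (m := Fin n) (ι : B →+* A))
  let u : (CStarMatrix (Fin n) (Fin n) A)ˣ :=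
    { val := (↑z⁻¹ : CStarMatrix (Fin n) (Fin n) B).map ι
      inv := (z : CStarMatrix (Fin n) (Fin n) B).map ι
      val_inv := by rw [hmul, z.inv_mul, hone]
      inv_val := by rw [hmul, z.mul_inv, hone] }
  obtain ⟨v, hv⟩ := isUnit_one_sub_of_norm_lt_one hz
  have hvu : (↑z⁻¹ : CStarMatrix (Fin n) (Fin n) B).map ι - amp n X = ↑(v * u) := by
    rw [Units.val_mul, hv, sub_mul, one_mul, mul_assoc]
    rw [show (z : CStarMatrix (Fin n) (Fin n) B).map ι * (u : CStarMatrix (Fin n) (Fin n) A) = 1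
      from u.inv_mul, mul_one]
  rw [hvu, Ring.inverse_unit, mul_inv_rev, Units.val_mul]
  rwa [← hv, Ring.inverse_unit] at h

end Resolvent

end OperatorValued

end

noncomputable section

/-! The defining relation `K(z)⁻¹ = z⁻¹ + R(z)` reduces the convolution identity to one computation:
for `r = R(z)`, the R-transform of `X`, the element `w' = z (1 + η(r) z)⁻¹` must satisfy `E[t] = z`,
where `t = V w' (1 - V*XV w')⁻¹ V*`. The sandwich relation lets `η(r)` inside the compression be
traded for `r` outside it, which gives `t (1 - (X - r) V z V*) = V z V*` (`compress_mul_one_sub`).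
Write `V z V* = z + u`; then `u` is centred because `E[V z V*] = z`. Moreover `1 - (X - r)(z + u) =
(1 - (X - r) z)(1 - a u)` with `a = (1 - (X - r) z)⁻¹ (X - r)`, and `a` is centred by the choice of
`r`. Hence `t = (z + u)(1 - a u)⁻¹ (1 + a z)`. Up to factors `z` at the ends, every term of its
expansion other than `z` is an alternating word in `a` and `u`, so freeness leaves `E[t] = z`
(`exp_compress_resolvent`).

The analysis is done in Banach algebras with a bimodule projection and then applied to all `M_n(B)`
at once. The radius is independent of `n` since the norms of the amplified `X`, `V`, `E` and `η`
have bounds independent of `n`. Freeness passes to matrices because the entries of alternating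
products of centred matrices are sums of alternating words (`alternatingWordsVanish_matrix`);
resolvents are only in the closures of the generated algebras, so closures are used throughout.

That the compressed map is a bimodule map follows from `E[(Vb - bV)(Vb - bV)*] = 0` and
Cauchy-Schwarz: under `E`, the element `V` commutes with `B`. -/

namespace OperatorValued

/-! ### Neumann series and the inverse function theorem. -/

section InverseOneSub

variable {R : Type*} [NormedRing R] [CompleteSpace R]

theorem one_sub_mul_inverse {t : R} (ht : ‖t‖ < 1) : (1 - t) * Ring.inverse (1 - t) = 1 :=
  Ring.mul_inverse_cancel _ (isUnit_one_sub_of_norm_lt_one ht)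

theorem inverse_one_sub_mul {t : R} (ht : ‖t‖ < 1) : Ring.inverse (1 - t) * (1 - t) = 1 :=
  Ring.inverse_mul_cancel _ (isUnit_one_sub_of_norm_lt_one ht)

/-- The unit is only assumed to have norm at most `1`, so that the zero ring is covered; it occurs
as the ring of `0 × 0` matrices. -/
theorem norm_inverse_one_sub_le {t : R} (h1 : ‖(1 : R)‖ ≤ 1) (ht : ‖t‖ ≤ 1 / 2) :
    ‖Ring.inverse (1 - t)‖ ≤ 2 := by
  have h := one_sub_mul_inverse (t := t) (by linarith)
  have h2 : Ring.inverse (1 - t) = 1 + t * Ring.inverse (1 - t) := by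
    rw [sub_mul, one_mul, sub_eq_iff_eq_add] at h
    exact h
  have h3 : ‖Ring.inverse (1 - t)‖ ≤ 1 + 1 / 2 * ‖Ring.inverse (1 - t)‖ := by
    conv_lhs => rw [h2]
    refine (norm_add_le _ _).trans (add_le_add h1 ((norm_mul_le _ _).trans ?_))
    gcongr
  linarith

theorem norm_inverse_one_sub_sub_one_le {t : R} (h1 : ‖(1 : R)‖ ≤ 1) (ht : ‖t‖ ≤ 1 / 2) :
    ‖Ring.inverse (1 - t) - 1‖ ≤ 2 * ‖t‖ := by
  have h := one_sub_mul_inverse (t := t) (by linarith)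
  have h2 : Ring.inverse (1 - t) - 1 = t * Ring.inverse (1 - t) := by
    rw [sub_mul, one_mul, sub_eq_iff_eq_add] at h
    rw [sub_eq_iff_eq_add, add_comm]
    exact h
  rw [h2, mul_comm 2]
  refine (norm_mul_le _ _).trans ?_
  gcongr
  exact norm_inverse_one_sub_le h1 ht

end InverseOneSub

/-- Quantitative holomorphic inverse function theorem for a perturbation of the identity. -/
theorem exists_differentiableOn_inverse {F : Type*} [NormedAddCommGroup F] [NormedSpace ℂ F]
    [CompleteSpace F] {f : F → F} {r : ℝ} (hr : 0 < r) (f0 : f 0 = 0)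
    (hf : ∀ w ∈ Metric.closedBall (0 : F) r, ∀ w' ∈ Metric.closedBall (0 : F) r,
      ‖f w - f w' - (w - w')‖ ≤ 1 / 2 * ‖w - w'‖)
    (hd : ∀ w ∈ Metric.ball (0 : F) r, DifferentiableAt ℂ f w) :
    ∃ K : F → F, DifferentiableOn ℂ K (Metric.ball 0 (r / 2)) ∧ K 0 = 0 ∧
      ∀ z ∈ Metric.ball (0 : F) (r / 2), ‖K z‖ ≤ 2 * ‖z‖ ∧ f (K z) = z := by
  have happ : ApproximatesLinearOn f (ContinuousLinearMap.id ℂ F) (Metric.closedBall 0 r)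
      (1 / 2 : NNReal) := by
    intro w hw w' hw'
    simpa using hf w hw w' hw'
  let s : (ContinuousLinearMap.id ℂ F).NonlinearRightInverse :=
    { toFun := id
      nnnorm := 1
      bound' := by simp
      right_inv' := by simp }
  have hsurj := happ.surjOn_closedBall_of_nonlinearRightInverse s hr.le subset_rfl
  rw [f0] at hsurj
  -- The right inverse of the linear part has norm `1` and the defect is `1/2`, so the image covers
  -- the ball of radius `(1 - 1/2) r`.
  have hrad : (((s.nnnorm : ℝ))⁻¹ - ((1 / 2 : NNReal) : ℝ)) * r = r / 2 := by
    simp only [s]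
    push_cast
    ring
  rw [hrad] at hsurj
  replace hsurj : ∀ z ∈ Metric.closedBall (0 : F) (r / 2),
      ∃ w, w ∈ Metric.closedBall (0 : F) r ∧ f w = z := fun z hz => hsurj hz
  have h0 : (0 : F) ∈ Metric.closedBall (0 : F) r := by simp [hr.le]
  have lower : ∀ w ∈ Metric.closedBall (0 : F) r, ∀ w' ∈ Metric.closedBall (0 : F) r,
      ‖w - w'‖ ≤ 2 * ‖f w - f w'‖ := by
    intro w hw w' hw'
    have h1 := hf w hw w' hw'
    have h2 := norm_sub_norm_le (w - w') (f w - f w')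
    rw [norm_sub_rev (w - w')] at h2
    linarith
  choose! K hK using hsurj
  have hmem : ∀ z ∈ Metric.ball (0 : F) (r / 2), z ∈ Metric.closedBall (0 : F) (r / 2) :=
    fun z hz => Metric.ball_subset_closedBall hz
  have hle : ∀ z ∈ Metric.ball (0 : F) (r / 2), ‖K z‖ ≤ 2 * ‖z‖ := by
    intro z hz
    have h := lower _ (hK z (hmem z hz)).1 0 h0
    rwa [(hK z (hmem z hz)).2, f0, sub_zero, sub_zero] at h
  refine ⟨K, ?_, ?_, fun z hz => ⟨hle z hz, (hK z (hmem z hz)).2⟩⟩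
  · intro z hz
    have hKz : K z ∈ Metric.ball (0 : F) r := by
      have := hle z hz
      rw [mem_ball_zero_iff] at hz ⊢
      linarith
    have hcont : ContinuousAt K z := by
      refine continuousAt_of_locally_lipschitz (r := r / 2 - ‖z‖) (by simpa using hz) 2 ?_
      intro y hy
      have hy' : y ∈ Metric.ball (0 : F) (r / 2) := by
        rw [mem_ball_zero_iff]
        have := norm_sub_norm_le y z
        rw [dist_eq_norm] at hy
        linarith
      have h := lower _ (hK y (hmem y hy')).1 _ (hK z (hmem z hz)).1
      rwa [(hK y (hmem y hy')).2, (hK z (hmem z hz)).2, ← dist_eq_norm, ← dist_eq_norm] at h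
    have hder := (hd _ hKz).hasFDerivAt
    set L := fderiv ℂ f (K z)
    -- The Lipschitz bound on `f - id` bounds its derivative, so `L` is invertible by a Neumann
    -- series.
    have hL : ‖ContinuousLinearMap.id ℂ F - L‖ ≤ 1 / 2 := by
      rw [norm_sub_rev]
      refine (hder.sub (hasFDerivAt_id (K z))).le_of_lip' (by norm_num) ?_
      filter_upwards [Metric.isOpen_ball.mem_nhds hKz] with w hw
      have := hf w (Metric.ball_subset_closedBall hw) _ (Metric.ball_subset_closedBall hKz)
      refine le_trans (le_of_eq ?_) this
      congr 1
      simp only [Pi.sub_apply, id]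
      abel
    let u : (F →L[ℂ] F)ˣ := Units.oneSub (1 - L) (lt_of_le_of_lt hL (by norm_num))
    have hu : ((ContinuousLinearEquiv.unitsEquiv ℂ F u : F ≃L[ℂ] F) : F →L[ℂ] F) = L := by
      ext x
      simp [u]
    have hKd := HasFDerivAt.of_local_left_inverse (f' := ContinuousLinearEquiv.unitsEquiv ℂ F u)
      hcont (by rw [hu]; exact hder)
      (by filter_upwards [Metric.isOpen_ball.mem_nhds hz] with y hy using (hK y (hmem y hy)).2)
    exact hKd.differentiableAt.differentiableWithinAt
  · have := hle 0 (by simp [hr])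
    simpa using this

/-! ### Cauchy transform and R-transform in Banach algebras. -/

section Banach

variable {𝔄 𝔅 : Type*} [NormedRing 𝔄] [NormedAlgebra ℂ 𝔄]
  [NormedRing 𝔅] [NormedAlgebra ℂ 𝔅]

/-- A `𝔅`-bimodule projection `E` of Banach algebras along a contractive inclusion `ι`, and an
element `X`, with `E` and `X` bounded by `M`. -/
structure IsBoundedExpectation (ι : 𝔅 →ₐ[ℂ] 𝔄) (E : 𝔄 →L[ℂ] 𝔅) (X : 𝔄) (M : ℝ) : Prop where
  one_le : 1 ≤ M
  norm_one_left : ‖(1 : 𝔄)‖ ≤ 1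
  norm_one_right : ‖(1 : 𝔅)‖ ≤ 1
  norm_incl : ∀ b, ‖ι b‖ ≤ ‖b‖
  norm_exp : ∀ a, ‖E a‖ ≤ M * ‖a‖
  norm_le : ‖X‖ ≤ M
  apply_incl : ∀ b, E (ι b) = b
  map_incl_mul : ∀ b a, E (ι b * a) = b * E a
  map_mul_incl : ∀ a b, E (a * ι b) = E a * b

/-- The transform `w ↦ E[w (1 - X w)⁻¹]`. -/
def cauchyMap (ι : 𝔅 →ₐ[ℂ] 𝔄) (E : 𝔄 →L[ℂ] 𝔅) (X : 𝔄) (w : 𝔅) : 𝔅 :=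
  E (ι w * Ring.inverse (1 - X * ι w))

/-- The transform `w ↦ E[X (1 - w X)⁻¹]`. -/
def momentMap (ι : 𝔅 →ₐ[ℂ] 𝔄) (E : 𝔄 →L[ℂ] 𝔅) (X : 𝔄) (w : 𝔅) : 𝔅 :=
  E (X * Ring.inverse (1 - ι w * X))

namespace IsBoundedExpectation

variable {ι : 𝔅 →ₐ[ℂ] 𝔄} {E : 𝔄 →L[ℂ] 𝔅} {X : 𝔄} {M : ℝ}

theorem pos (h : IsBoundedExpectation ι E X M) : 0 < M := lt_of_lt_of_le one_pos h.one_le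

theorem norm_mul_incl (h : IsBoundedExpectation ι E X M) (w : 𝔅) : ‖X * ι w‖ ≤ M * ‖w‖ :=
  (norm_mul_le _ _).trans (mul_le_mul h.norm_le (h.norm_incl w) (norm_nonneg _) h.pos.le)

theorem norm_incl_mul (h : IsBoundedExpectation ι E X M) (w : 𝔅) : ‖ι w * X‖ ≤ M * ‖w‖ := by
  rw [mul_comm M]
  exact (norm_mul_le _ _).trans (mul_le_mul (h.norm_incl w) h.norm_le (norm_nonneg _)
    (norm_nonneg _))

theorem differentiable_incl (h : IsBoundedExpectation ι E X M) :
    Differentiable ℂ (fun w => ι w) :=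
  (ι.toLinearMap.mkContinuous 1 (fun b => by simpa using h.norm_incl b)).differentiable

theorem mul_norm_le_of_radius (h : IsBoundedExpectation ι E X M) {w : 𝔅}
    (hw : ‖w‖ ≤ 1 / (12 * M ^ 2)) : M * ‖w‖ ≤ 1 / (12 * M) ∧ M * ‖w‖ ≤ 1 / 12 := by
  have hM := h.pos
  have h1 : M * ‖w‖ ≤ 1 / (12 * M) := by
    calc M * ‖w‖ ≤ M * (1 / (12 * M ^ 2)) := by gcongr
      _ = 1 / (12 * M) := by field_simp
  refine ⟨h1, h1.trans ?_⟩
  apply one_div_le_one_div_of_le (by norm_num)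
  linarith [h.one_le]

variable [CompleteSpace 𝔄]

/-- One step of the geometric series, after `(1 - wX)⁻¹ w = w (1 - Xw)⁻¹`. This form allows the
R-transform to be written without inverting `w` or `z`. -/
theorem cauchyMap_eq (h : IsBoundedExpectation ι E X M) {w : 𝔅} (hw : M * ‖w‖ < 1) :
    cauchyMap ι E X w = w * (1 + momentMap ι E X w * w) := by
  have h1 := one_sub_mul_inverse ((h.norm_mul_incl w).trans_lt hw)
  have h2 := inverse_one_sub_mul ((h.norm_incl_mul w).trans_lt hw)
  unfold cauchyMap momentMap
  set Q := Ring.inverse (1 - X * ι w)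
  set P := Ring.inverse (1 - ι w * X)
  have h3 : P * ι w = ι w * Q := by
    calc P * ι w = P * ι w * ((1 - X * ι w) * Q) := by rw [h1, mul_one]
      _ = (P * (1 - ι w * X)) * ι w * Q := by noncomm_ring
      _ = ι w * Q := by rw [h2, one_mul]
  have h4 : Q = 1 + X * P * ι w := by
    rw [sub_mul, one_mul, sub_eq_iff_eq_add] at h1
    rw [mul_assoc, h3, ← mul_assoc]
    exact h1
  rw [h.map_incl_mul, h4, map_add, h.map_mul_incl, ← map_one ι, h.apply_incl]

theorem exp_inverse_eq (h : IsBoundedExpectation ι E X M) {w : 𝔅} (hw : M * ‖w‖ < 1) :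
    E (Ring.inverse (1 - ι w * X)) = 1 + w * momentMap ι E X w := by
  have h2 := one_sub_mul_inverse ((h.norm_incl_mul w).trans_lt hw)
  unfold momentMap
  rw [sub_mul, one_mul, sub_eq_iff_eq_add, mul_assoc] at h2
  conv_lhs => rw [h2]
  rw [map_add, h.map_incl_mul, ← map_one ι, h.apply_incl]

theorem cauchyMap_approximates (h : IsBoundedExpectation ι E X M) {w w' : 𝔅}
    (hw : ‖w‖ ≤ 1 / (12 * M ^ 2)) (hw' : ‖w'‖ ≤ 1 / (12 * M ^ 2)) :
    ‖cauchyMap ι E X w - cauchyMap ι E X w' - (w - w')‖ ≤ 1 / 2 * ‖w - w'‖ := by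
  obtain ⟨e1, e2⟩ := h.mul_norm_le_of_radius hw
  obtain ⟨e1', e2'⟩ := h.mul_norm_le_of_radius hw'
  have n1 := h.norm_incl_mul w
  have n2 := h.norm_mul_incl w'
  have n3 := h.norm_mul_incl w
  have i1 := one_sub_mul_inverse (t := X * ι w) (by linarith)
  have i2 := inverse_one_sub_mul (t := ι w * X) (by linarith)
  have i3 := one_sub_mul_inverse (t := X * ι w') (by linarith)
  have b1 := norm_inverse_one_sub_sub_one_le (t := ι w * X) h.norm_one_left (by linarith)
  have b2 := norm_inverse_one_sub_sub_one_le (t := X * ι w') h.norm_one_left (by linarith)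
  have b3 := norm_inverse_one_sub_le (t := X * ι w') h.norm_one_left (by linarith)
  unfold cauchyMap
  set Q := Ring.inverse (1 - X * ι w)
  set P := Ring.inverse (1 - ι w * X)
  set Q' := Ring.inverse (1 - X * ι w')
  have h3 : ι w * Q = P * ι w := by
    calc ι w * Q = (P * (1 - ι w * X)) * ι w * Q := by rw [i2, one_mul]
      _ = P * ι w * ((1 - X * ι w) * Q) := by noncomm_ring
      _ = P * ι w := by rw [i1, mul_one]
  have h4 : ι w * Q - ι w' * Q' = P * ι (w - w') * Q' := by
    calc ι w * Q - ι w' * Q' = P * ι w * ((1 - X * ι w') * Q')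
          - (P * (1 - ι w * X)) * ι w' * Q' := by rw [h3, i3, i2, mul_one, one_mul]
      _ = P * ι (w - w') * Q' := by rw [map_sub]; noncomm_ring
  -- The two summands contribute `M (1/(3M) + 1/(6M)) = 1/2`; the radius `1/(12 M²)` is chosen for
  -- this.
  have h5 : E (ι w * Q) - E (ι w' * Q') - (w - w')
      = E ((P - 1) * ι (w - w') * Q' + ι (w - w') * (Q' - 1)) := by
    rw [← map_sub, h4]
    calc _ = E (P * ι (w - w') * Q') - E (ι (w - w')) := by rw [h.apply_incl]
      _ = _ := by
        rw [← map_sub]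
        congr 1
        noncomm_ring
  rw [h5]
  have hM := h.pos
  have hd := h.norm_incl (w - w')
  have p1 : ‖(P - 1) * ι (w - w') * Q'‖ ≤ 2 * (1 / (12 * M)) * ‖w - w'‖ * 2 := by
    refine (norm_mul_le _ _).trans (mul_le_mul ((norm_mul_le _ _).trans ?_) b3 (norm_nonneg _)
      (by positivity))
    exact mul_le_mul (by linarith) hd (norm_nonneg _) (by positivity)
  have p2 : ‖ι (w - w') * (Q' - 1)‖ ≤ ‖w - w'‖ * (2 * (1 / (12 * M))) :=
    (norm_mul_le _ _).trans (mul_le_mul hd (by linarith) (norm_nonneg _) (by positivity))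
  calc _ ≤ M * (2 * (1 / (12 * M)) * ‖w - w'‖ * 2 + ‖w - w'‖ * (2 * (1 / (12 * M)))) := by
        refine (h.norm_exp _).trans ?_
        gcongr
        exact (norm_add_le _ _).trans (add_le_add p1 p2)
    _ = 1 / 2 * ‖w - w'‖ := by field_simp; ring

theorem differentiableAt_cauchyMap (h : IsBoundedExpectation ι E X M) {w : 𝔅}
    (hw : M * ‖w‖ < 1) : DifferentiableAt ℂ (cauchyMap ι E X) w := by
  have hι := h.differentiable_incl w
  refine E.differentiableAt.comp w (hι.mul ?_)
  exact (differentiableAt_inverse (isUnit_one_sub_of_norm_lt_one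
    ((h.norm_mul_incl w).trans_lt hw))).comp w ((differentiableAt_const _).sub (hι.const_mul X))

theorem differentiableAt_momentMap (h : IsBoundedExpectation ι E X M) {w : 𝔅}
    (hw : M * ‖w‖ < 1) : DifferentiableAt ℂ (momentMap ι E X) w := by
  have hι := h.differentiable_incl w
  refine E.differentiableAt.comp w (DifferentiableAt.const_mul ?_ X)
  exact (differentiableAt_inverse (isUnit_one_sub_of_norm_lt_one
    ((h.norm_incl_mul w).trans_lt hw))).comp w ((differentiableAt_const _).sub (hι.mul_const X))

theorem norm_momentMap_le (h : IsBoundedExpectation ι E X M) {w : 𝔅}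
    (hw : M * ‖w‖ ≤ 1 / 2) : ‖momentMap ι E X w‖ ≤ 2 * M ^ 2 := by
  have hM := h.pos
  have h1 := norm_inverse_one_sub_le (t := ι w * X) h.norm_one_left
    ((h.norm_incl_mul w).trans hw)
  calc _ ≤ M * (M * 2) := by
        refine (h.norm_exp _).trans ?_
        gcongr
        exact (norm_mul_le _ _).trans (mul_le_mul h.norm_le h1 (norm_nonneg _) hM.le)
    _ = _ := by ring

variable [CompleteSpace 𝔅]

/-- The inverse function `K` of the Cauchy transform, and the R-transform `R`, with the relations
that hold between them. -/
theorem exists_rTransform (h : IsBoundedExpectation ι E X M) :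
    ∃ K R : 𝔅 → 𝔅, DifferentiableOn ℂ K (Metric.ball 0 (1 / (24 * M ^ 2))) ∧
      DifferentiableOn ℂ R (Metric.ball 0 (1 / (24 * M ^ 2))) ∧ K 0 = 0 ∧
      ∀ z ∈ Metric.ball (0 : 𝔅) (1 / (24 * M ^ 2)),
        M * ‖K z‖ ≤ 1 / 2 ∧ cauchyMap ι E X (K z) = z ∧ ‖R z‖ ≤ 4 * M ^ 2 ∧
        ‖momentMap ι E X (K z) * K z‖ ≤ 1 / 2 ∧ ‖K z * momentMap ι E X (K z)‖ ≤ 1 / 2 ∧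
        R z * z = momentMap ι E X (K z) * K z ∧ z * R z = K z * momentMap ι E X (K z) ∧
        R z + R z * (K z * momentMap ι E X (K z)) = momentMap ι E X (K z) := by
  have hM := h.pos
  have hr : 0 < 1 / (12 * M ^ 2) := by positivity
  have hrr : ∀ w ∈ Metric.ball (0 : 𝔅) (1 / (12 * M ^ 2)), M * ‖w‖ ≤ 1 / 12 := fun w hw =>
    (h.mul_norm_le_of_radius (by rw [mem_ball_zero_iff] at hw; exact hw.le)).2
  obtain ⟨K, hK, K0, hKz⟩ := exists_differentiableOn_inverse (f := cauchyMap ι E X) hr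
    (by simp [cauchyMap])
    (fun w hw w' hw' => h.cauchyMap_approximates (by simpa using hw) (by simpa using hw'))
    (fun w hw => h.differentiableAt_cauchyMap (by linarith [hrr w hw]))
  have hrad : 1 / (12 * M ^ 2) / 2 = 1 / (24 * M ^ 2) := by field_simp; norm_num
  rw [hrad] at hK hKz
  have hsmall : ∀ z ∈ Metric.ball (0 : 𝔅) (1 / (24 * M ^ 2)),
      ‖K z‖ ≤ 1 / (12 * M ^ 2) ∧ M * ‖K z‖ ≤ 1 / 12 := by
    intro z hz
    have h1 : ‖K z‖ ≤ 1 / (12 * M ^ 2) := by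
      have := (hKz z hz).1
      rw [mem_ball_zero_iff, ← hrad] at hz
      linarith
    exact ⟨h1, (h.mul_norm_le_of_radius h1).2⟩
  have hH : ∀ z ∈ Metric.ball (0 : 𝔅) (1 / (24 * M ^ 2)),
      ‖momentMap ι E X (K z)‖ ≤ 2 * M ^ 2 ∧ ‖momentMap ι E X (K z) * K z‖ ≤ 1 / 2 ∧
      ‖K z * momentMap ι E X (K z)‖ ≤ 1 / 2 := by
    intro z hz
    have h1 := h.norm_momentMap_le (w := K z) (by linarith [(hsmall z hz).2])
    have h2 : ‖momentMap ι E X (K z)‖ * ‖K z‖ ≤ 1 / 2 := by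
      calc _ ≤ 2 * M ^ 2 * (1 / (12 * M ^ 2)) := by
            gcongr
            exact (hsmall z hz).1
        _ ≤ 1 / 2 := by field_simp; norm_num
    refine ⟨h1, (norm_mul_le _ _).trans h2, (norm_mul_le _ _).trans ?_⟩
    rwa [mul_comm]
  -- With `H = momentMap ι E X w` and `w = K z`, the relation `z = w (1 + H w)` gives `w⁻¹ - z⁻¹ =
  -- (1 + H w)⁻¹ H` when the inverses exist; the right side makes sense without them. The double
  -- negation fits the Neumann series lemmas.
  refine ⟨K, fun z => Ring.inverse (1 - -(momentMap ι E X (K z) * K z)) * momentMap ι E X (K z),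
    hK, ?_, K0, ?_⟩
  · intro z hz
    have hKd : DifferentiableWithinAt ℂ K _ z := hK z hz
    have hHd : DifferentiableWithinAt ℂ (fun z => momentMap ι E X (K z))
        (Metric.ball 0 (1 / (24 * M ^ 2))) z :=
      (h.differentiableAt_momentMap (by linarith [(hsmall z hz).2])).comp_differentiableWithinAt z
        hKd
    refine DifferentiableWithinAt.mul ?_ hHd
    refine (differentiableAt_inverse (isUnit_one_sub_of_norm_lt_one (x :=
      -(momentMap ι E X (K z) * K z)) ?_)).comp_differentiableWithinAt z
      ((differentiableWithinAt_const _).sub (hHd.mul hKd).neg)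
    rw [norm_neg]
    linarith [(hH z hz).2.1]
  · intro z hz
    have hw := (hsmall z hz).2
    have hG := (hKz z hz).2
    obtain ⟨m1, m2, m3⟩ := hH z hz
    have hG' := hG
    rw [h.cauchyMap_eq (by linarith)] at hG'
    set H := momentMap ι E X (K z)
    set w := K z
    have i1 := one_sub_mul_inverse (t := -(H * w)) (by rw [norm_neg]; linarith)
    have i2 := inverse_one_sub_mul (t := -(H * w)) (by rw [norm_neg]; linarith)
    have i3 := norm_inverse_one_sub_le (t := -(H * w)) h.norm_one_right (by rw [norm_neg]; linarith)
    rw [sub_neg_eq_add] at i1 i2 i3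
    refine ⟨by linarith, hG, ?_, m2, m3, ?_, ?_, ?_⟩
    · beta_reduce
      rw [sub_neg_eq_add]
      calc _ ≤ 2 * (2 * M ^ 2) :=
            (norm_mul_le _ _).trans (mul_le_mul i3 m1 (norm_nonneg _) (by norm_num))
        _ = _ := by ring
    · beta_reduce
      rw [sub_neg_eq_add]
      set D := Ring.inverse (1 + H * w)
      calc D * H * z = D * (H * (w * (1 + H * w))) := by rw [hG', mul_assoc]
        _ = (D * (1 + H * w)) * (H * w) := by noncomm_ring
        _ = H * w := by rw [i2, one_mul]
    · beta_reduce
      rw [sub_neg_eq_add]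
      set D := Ring.inverse (1 + H * w)
      calc z * (D * H) = w * ((1 + H * w) * D) * H := by rw [← hG']; noncomm_ring
        _ = w * H := by rw [i1, mul_one]
    · beta_reduce
      rw [sub_neg_eq_add]
      set D := Ring.inverse (1 + H * w)
      calc D * H + D * H * (w * H) = (D * (1 + H * w)) * H := by noncomm_ring
        _ = H := by rw [i2, one_mul]

end IsBoundedExpectation

end Banach

/-! ### Freeness and the compressed resolvent. -/

section Banach

variable {𝔄 𝔅 : Type*} [NormedRing 𝔄] [NormedAlgebra ℂ 𝔄]
  [NormedRing 𝔅] [NormedAlgebra ℂ 𝔅]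

/-- The alternating words in two letters, with any first and last letters, have expectation `0`. -/
def AlternatingWordsVanish (E : 𝔄 →L[ℂ] 𝔅) (a u : 𝔄) : Prop :=
  ∀ k : ℕ, E ((a * u) ^ (k + 1)) = 0 ∧ E (u * (a * u) ^ k) = 0 ∧ E ((a * u) ^ k * a) = 0 ∧
    E (u * (a * u) ^ k * a) = 0

/-- The four values are those needed to expand `(z + u)(1 - a u)⁻¹ (1 + a z)` under `E`. Only the
empty word, the zeroth term of the first series, survives. -/
theorem AlternatingWordsVanish.exp_geometric [CompleteSpace 𝔄] {E : 𝔄 →L[ℂ] 𝔅} {a u : 𝔄}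
    (hw : AlternatingWordsVanish E a u) (hau : ‖a * u‖ < 1) :
    E (Ring.inverse (1 - a * u)) = E 1 ∧ E (u * Ring.inverse (1 - a * u)) = 0 ∧
      E (Ring.inverse (1 - a * u) * a) = 0 ∧ E (u * Ring.inverse (1 - a * u) * a) = 0 := by
  have hs := hasSum_geom_series_inverse (a * u) hau
  have hmap (f : 𝔄 →L[ℂ] 𝔅) (hf : ∀ k, f ((a * u) ^ k) = 0) :
      f (Ring.inverse (1 - a * u)) = 0 := by
    have h1 := f.hasSum hs
    simp only [hf] at h1
    exact h1.unique hasSum_zero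
  refine ⟨?_, ?_, ?_, ?_⟩
  · have h1 := E.hasSum hs
    refine h1.unique ?_
    have h2 := hasSum_single (f := fun k => E ((a * u) ^ k)) 0 (fun k hk => by
      obtain ⟨m, rfl⟩ := Nat.exists_eq_succ_of_ne_zero hk
      exact (hw m).1)
    simpa using h2
  · exact hmap (E ∘L ContinuousLinearMap.mul ℂ 𝔄 u) fun k => (hw k).2.1
  · exact hmap (E ∘L (ContinuousLinearMap.mul ℂ 𝔄).flip a) fun k => (hw k).2.2.1
  · exact hmap (E ∘L (ContinuousLinearMap.mul ℂ 𝔄).flip a ∘L ContinuousLinearMap.mul ℂ 𝔄 u)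
      fun k => (hw k).2.2.2

theorem inverse_one_sub_mem [CompleteSpace 𝔄] {S : Subalgebra ℂ 𝔄} (hS : IsClosed (S : Set 𝔄))
    {t : 𝔄} (ht : t ∈ S) (h1 : ‖t‖ < 1) : Ring.inverse (1 - t) ∈ S :=
  hS.mem_of_tendsto (hasSum_geom_series_inverse t h1)
    (Filter.Eventually.of_forall fun _ => S.sum_mem fun _ _ => S.pow_mem ht _)

/-- An element `V` of a probability space, paired with `W` (its adjoint in applications), that
compresses as in the construction of the `η`-free convolution power. -/
structure IsCompressor (ι : 𝔅 →ₐ[ℂ] 𝔄) (E : 𝔄 →L[ℂ] 𝔅) (η : 𝔅 →L[ℂ] 𝔅) (V W : 𝔄) (M : ℝ) :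
    Prop where
  norm_left : ‖V‖ ≤ M
  norm_right : ‖W‖ ≤ M
  norm_map : ∀ b, ‖η b‖ ≤ M * ‖b‖
  sandwich : ∀ b₁ b₂, V * ι b₁ * W * ι b₂ * V = V * ι b₁ * ι (η b₂)
  exp_compress : ∀ b, E (V * ι b * W) = b

variable [CompleteSpace 𝔄]

/-- Moving the resolvent to the left of `V w` puts `V w W r V` together, so that the sandwich
relation replaces `W r V` by `η r`. The remaining factor `1 + η(r) z - W X V z` is `(1 - W X V w)(1
+ η(r) z)`, which cancels the resolvent. -/
theorem compress_mul_one_sub {ι : 𝔅 →ₐ[ℂ] 𝔄} {E : 𝔄 →L[ℂ] 𝔅} {η : 𝔅 →L[ℂ] 𝔅} {X V W : 𝔄}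
    {M : ℝ} (hc : IsCompressor ι E η V W M) {z w r : 𝔅} (hw : w * (1 + η r * z) = z)
    (h1 : ‖W * X * V * ι w‖ < 1) (h2 : ‖V * ι w * W * X‖ < 1) :
    V * (ι w * Ring.inverse (1 - W * X * V * ι w)) * W * (1 - (X - ι r) * (V * ι z * W)) =
      V * ι z * W := by
  have i1 := one_sub_mul_inverse h1
  have i1' := inverse_one_sub_mul h1
  have i2 := inverse_one_sub_mul h2
  set D := Ring.inverse (1 - W * X * V * ι w)
  set L := Ring.inverse (1 - V * ι w * W * X)
  have e1 : V * ι w * D = L * V * ι w := by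
    calc V * ι w * D = (L * (1 - V * ι w * W * X)) * (V * ι w * D) := by rw [i2, one_mul]
      _ = L * V * ι w * ((1 - W * X * V * ι w) * D) := by noncomm_ring
      _ = _ := by rw [i1, mul_one]
  have e2 : V * ι w * D * W * ι r * V = V * ι w * D * ι (η r) := by
    calc V * ι w * D * W * ι r * V = L * (V * ι w * W * ι r * V) := by
          rw [e1]; noncomm_ring
      _ = (L * V * ι w) * ι (η r) := by rw [hc.sandwich]; noncomm_ring
      _ = _ := by rw [← e1]
  have e3 : ι z = ι w * (1 + ι (η r) * ι z) := by
    rw [← map_mul, ← map_one ι, ← map_add, ← map_mul, hw]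
  calc _ = V * ι w * D * (1 - W * X * V * ι z) * W + (V * ι w * D * W * ι r * V) * ι z * W := by
        noncomm_ring
    _ = V * ι w * D * ((1 + ι (η r) * ι z) - W * X * V * ι z) * W := by
        rw [e2]; noncomm_ring
    _ = V * ι w * D * ((1 + ι (η r) * ι z) - W * X * V * (ι w * (1 + ι (η r) * ι z))) * W := by
        rw [← e3]
    _ = V * ι w * (D * (1 - W * X * V * ι w)) * (1 + ι (η r) * ι z) * W := by noncomm_ring
    _ = V * (ι w * (1 + ι (η r) * ι z)) * W := by rw [i1', mul_one]; noncomm_ring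
    _ = _ := by rw [← e3]

variable [CompleteSpace 𝔅]

/-- With `H = momentMap ι E X w`, the value `r` of the R-transform enters only through `z r = w H`
and `r (1 + w H) = H`. The second identity centres `a`, the first factors `1 - z (X - r)`. -/
theorem exp_compress_resolvent {ι : 𝔅 →ₐ[ℂ] 𝔄} {E : 𝔄 →L[ℂ] 𝔅} {η : 𝔅 →L[ℂ] 𝔅} {X V W : 𝔄}
    {M : ℝ} (h : IsBoundedExpectation ι E X M) (hc : IsCompressor ι E η V W M)
    {S T : Subalgebra ℂ 𝔄} (hS : IsClosed (S : Set 𝔄)) (hιS : ∀ b, ι b ∈ S) (hXS : X ∈ S)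
    (hιT : ∀ b, ι b ∈ T) (hVT : V ∈ T) (hWT : W ∈ T)
    (hfree : ∀ a ∈ S, E a = 0 → ∀ u ∈ T, E u = 0 → AlternatingWordsVanish E a u)
    {z w w' r : 𝔅} (hz : ‖z‖ < 1 / (100 * M ^ 4)) (hw : M * ‖w‖ ≤ 1 / 2)
    (hG : cauchyMap ι E X w = z) (hr : ‖r‖ ≤ 4 * M ^ 2)
    (hH : ‖w * momentMap ι E X w‖ ≤ 1 / 2) (hzr : z * r = w * momentMap ι E X w)
    (hrH : r + r * (w * momentMap ι E X w) = momentMap ι E X w)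
    (hw' : w' * (1 + η r * z) = z)
    (h1 : ‖W * X * V * ι w'‖ < 1) (h2 : ‖V * ι w' * W * X‖ < 1) :
    E (V * (ι w' * Ring.inverse (1 - W * X * V * ι w')) * W) = z := by
  have hM := h.pos
  have hT := compress_mul_one_sub hc hw' h1 h2
  set t := V * (ι w' * Ring.inverse (1 - W * X * V * ι w')) * W
  have hwX : ‖ι w * X‖ ≤ 1 / 2 := (h.norm_incl_mul w).trans hw
  rw [h.cauchyMap_eq (by linarith)] at hG
  have hEP := h.exp_inverse_eq (w := w) (by linarith)
  have iP := one_sub_mul_inverse (t := ι w * X) (by linarith)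
  have iP' := inverse_one_sub_mul (t := ι w * X) (by linarith)
  have nP := norm_inverse_one_sub_le h.norm_one_left hwX
  have hHm : E (X * Ring.inverse (1 - ι w * X)) = momentMap ι E X w := rfl
  set H := momentMap ι E X w
  have iD := one_sub_mul_inverse (t := -(w * H)) (by rw [norm_neg]; linarith)
  have iD' := inverse_one_sub_mul (t := -(w * H)) (by rw [norm_neg]; linarith)
  have nD := norm_inverse_one_sub_le (t := -(w * H)) h.norm_one_right (by rwa [norm_neg])
  set D := Ring.inverse (1 - -(w * H))
  rw [sub_neg_eq_add] at iD iD'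
  have mP : Ring.inverse (1 - ι w * X) ∈ S :=
    inverse_one_sub_mem hS (S.mul_mem (hιS w) hXS) (by linarith)
  set P := Ring.inverse (1 - ι w * X)
  -- This is `(X - r)(1 - z (X - r))⁻¹`, in a form that shows membership in `S` and whose
  -- expectation is computable.
  set a := (X - ι r) * P * ι D with ha
  set u := V * ι z * W - ι z with hu
  have maS : a ∈ S := S.mul_mem (S.mul_mem (S.sub_mem hXS (hιS r)) mP) (hιS D)
  have muT : u ∈ T := T.sub_mem (T.mul_mem (T.mul_mem hVT (hιT z)) hWT) (hιT z)
  have Ea : E a = 0 := by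
    rw [ha, h.map_mul_incl, sub_mul, map_sub, h.map_incl_mul, hEP, hHm, mul_add, mul_one, hrH,
      sub_self, zero_mul]
  have Eu : E u = 0 := by rw [hu, map_sub, hc.exp_compress, h.apply_incl, sub_self]
  have hD : ι (1 + w * H) * ι D = 1 := by rw [← map_mul, iD, map_one]
  have hD' : ι D * ι (1 + w * H) = 1 := by rw [← map_mul, iD', map_one]
  have hfac : 1 - ι z * (X - ι r) = ι (1 + w * H) * (1 - ι w * X) := by
    have e1 : ι z * ι r = ι w * ι H := by rw [← map_mul, hzr, map_mul]
    have e2 : ι z = ι w * (1 + ι H * ι w) := by rw [← hG]; simp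
    calc _ = 1 - ι z * X + ι z * ι r := by noncomm_ring
      _ = 1 - ι w * (1 + ι H * ι w) * X + ι w * ι H := by rw [e1, ← e2]
      _ = (1 + ι w * ι H) * (1 - ι w * X) := by noncomm_ring
      _ = _ := by simp
  have hinv : (1 - ι z * (X - ι r)) * (P * ι D) = 1 := by
    calc _ = ι (1 + w * H) * ((1 - ι w * X) * P) * ι D := by rw [hfac]; noncomm_ring
      _ = 1 := by rw [iP, mul_one, hD]
  have hinv' : P * ι D * (1 - ι z * (X - ι r)) = 1 := by
    calc _ = P * (ι D * ι (1 + w * H)) * (1 - ι w * X) := by rw [hfac]; noncomm_ring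
      _ = 1 := by rw [hD', mul_one, iP']
  have ha1 : (1 - (X - ι r) * ι z) * a = X - ι r := by
    calc _ = (X - ι r) * ((1 - ι z * (X - ι r)) * (P * ι D)) := by rw [ha]; noncomm_ring
      _ = _ := by rw [hinv, mul_one]
  have ha2 : a * (1 - ι z * (X - ι r)) = X - ι r := by
    calc _ = (X - ι r) * (P * ι D * (1 - ι z * (X - ι r))) := by rw [ha]; noncomm_ring
      _ = _ := by rw [hinv', mul_one]
  have hu1 : V * ι z * W = ι z + u := by rw [hu]; abel
  have hsplit : 1 - (X - ι r) * (V * ι z * W) = (1 - (X - ι r) * ι z) * (1 - a * u) := by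
    calc _ = 1 - (X - ι r) * ι z - (X - ι r) * u := by rw [hu1]; noncomm_ring
      _ = 1 - (X - ι r) * ι z - ((1 - (X - ι r) * ι z) * a) * u := by rw [ha1]
      _ = _ := by noncomm_ring
  have hone : (1 - (X - ι r) * ι z) * (1 + a * ι z) = 1 := by
    calc _ = 1 - (X - ι r) * ι z + ((1 - (X - ι r) * ι z) * a) * ι z := by noncomm_ring
      _ = 1 := by rw [ha1]; abel
  have nau : ‖a * u‖ < 1 := by
    have n1 : ‖X - ι r‖ ≤ 5 * M ^ 2 := by
      have := norm_sub_le X (ι r)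
      have h3 := h.norm_incl r
      have h4 := h.norm_le
      nlinarith [h.one_le]
    have n2 : ‖a‖ ≤ 5 * M ^ 2 * 2 * 2 := by
      refine (norm_mul_le _ _).trans (mul_le_mul ((norm_mul_le _ _).trans
        (mul_le_mul n1 nP (norm_nonneg _) (by positivity))) ((h.norm_incl _).trans nD)
        (norm_nonneg _) (by positivity))
    have n3 : ‖u‖ ≤ 2 * M ^ 2 * ‖z‖ := by
      have h3 : ‖V * ι z * W‖ ≤ M * ‖z‖ * M :=
        (norm_mul_le _ _).trans (mul_le_mul ((norm_mul_le _ _).trans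
          (mul_le_mul hc.norm_left (h.norm_incl z) (norm_nonneg _) hM.le)) hc.norm_right
          (norm_nonneg _) (by positivity))
      have h4 := norm_sub_le (V * ι z * W) (ι z)
      have h5 := h.norm_incl z
      have h6 : ‖z‖ ≤ M ^ 2 * ‖z‖ :=
        le_mul_of_one_le_left (norm_nonneg _) (one_le_pow₀ h.one_le)
      linarith
    -- The bound is `40/100`; this estimate is where the fourth power of `M` in the radius comes
    -- from.
    calc ‖a * u‖ ≤ 5 * M ^ 2 * 2 * 2 * (2 * M ^ 2 * (1 / (100 * M ^ 4))) := by
          refine (norm_mul_le _ _).trans (mul_le_mul n2 (n3.trans ?_) (norm_nonneg _)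
            (by positivity))
          gcongr
      _ < 1 := by field_simp; norm_num
  obtain ⟨f1, f2, f3, f4⟩ := (hfree a maS Ea u muT Eu).exp_geometric nau
  have iS := one_sub_mul_inverse nau
  set s := Ring.inverse (1 - a * u)
  have ht : t = (ι z + u) * s * (1 + a * ι z) := by
    calc t = t * ((1 - (X - ι r) * ι z) * ((1 - a * u) * s) * (1 + a * ι z)) := by
          rw [iS, mul_one, hone, mul_one]
      _ = (t * ((1 - (X - ι r) * ι z) * (1 - a * u))) * s * (1 + a * ι z) := by
          simp only [mul_assoc]
      _ = _ := by rw [← hsplit, hT, hu1]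
  have E1 : E 1 = 1 := by rw [← map_one ι, h.apply_incl]
  calc E t = z * E s + E (u * s) + z * (E (s * a) * z) + E (u * s * a) * z := by
        rw [ht, ← h.map_incl_mul, ← h.map_mul_incl, ← h.map_incl_mul, ← h.map_mul_incl,
          ← map_add, ← map_add, ← map_add]
        congr 1
        noncomm_ring
    _ = z := by rw [f1, f2, f3, f4, E1]; simp

/-- The inverse functions of the Cauchy transforms of an element and of its compression, with a
function that is the R-transform of the element and whose image under `η` is that of the
compression. -/
theorem exists_rTransform_compress {ι : 𝔅 →ₐ[ℂ] 𝔄} {E : 𝔄 →L[ℂ] 𝔅} {η : 𝔅 →L[ℂ] 𝔅}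
    {X V W : 𝔄} {M : ℝ} (h : IsBoundedExpectation ι E X M) (hc : IsCompressor ι E η V W M)
    {S T : Subalgebra ℂ 𝔄} (hS : IsClosed (S : Set 𝔄)) (hιS : ∀ b, ι b ∈ S) (hXS : X ∈ S)
    (hιT : ∀ b, ι b ∈ T) (hVT : V ∈ T) (hWT : W ∈ T)
    (hfree : ∀ a ∈ S, E a = 0 → ∀ u ∈ T, E u = 0 → AlternatingWordsVanish E a u) :
    ∃ K K' R : 𝔅 → 𝔅,
      DifferentiableOn ℂ K (Metric.ball 0 (1 / (100 * M ^ 4))) ∧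
      DifferentiableOn ℂ K' (Metric.ball 0 (1 / (100 * M ^ 4))) ∧
      DifferentiableOn ℂ R (Metric.ball 0 (1 / (100 * M ^ 4))) ∧ K 0 = 0 ∧ K' 0 = 0 ∧
      ∀ z ∈ Metric.ball (0 : 𝔅) (1 / (100 * M ^ 4)),
        ‖X * ι (K z)‖ < 1 ∧ E (ι (K z) * Ring.inverse (1 - X * ι (K z))) = z ∧
        ‖W * X * V * ι (K' z)‖ < 1 ∧
        E (V * (ι (K' z) * Ring.inverse (1 - W * X * V * ι (K' z))) * W) = z ∧
        IsUnit (1 + R z * z) ∧ K z * (1 + R z * z) = z ∧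
        IsUnit (1 + η (R z) * z) ∧ K' z * (1 + η (R z) * z) = z := by
  have hM := h.pos
  have hM1 := h.one_le
  obtain ⟨K, R, hK, hR, K0, hz⟩ := h.exists_rTransform
  have hsub : Metric.ball (0 : 𝔅) (1 / (100 * M ^ 4)) ⊆ Metric.ball 0 (1 / (24 * M ^ 2)) := by
    refine Metric.ball_subset_ball (one_div_le_one_div_of_le (by positivity) ?_)
    have : M ^ 2 ≤ M ^ 4 := pow_le_pow_right₀ hM1 (by norm_num)
    nlinarith [sq_nonneg M]
  have hηR : ∀ z ∈ Metric.ball (0 : 𝔅) (1 / (100 * M ^ 4)), ‖η (R z) * z‖ ≤ 1 / 2 := by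
    intro z hzb
    have hr := (hz z (hsub hzb)).2.2.1
    rw [mem_ball_zero_iff] at hzb
    calc _ ≤ M * (4 * M ^ 2) * (1 / (100 * M ^ 4)) := by
          refine (norm_mul_le _ _).trans (mul_le_mul ((hc.norm_map _).trans ?_) hzb.le
            (norm_nonneg _) (by positivity))
          gcongr
      _ = 1 / (25 * M) := by field_simp; norm_num
      _ ≤ 1 / 2 := one_div_le_one_div_of_le (by norm_num) (by linarith)
  have hunit : ∀ z ∈ Metric.ball (0 : 𝔅) (1 / (100 * M ^ 4)), ‖-(η (R z) * z)‖ < 1 := by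
    intro z hzb
    rw [norm_neg]
    linarith [hηR z hzb]
  -- The candidate inverse function for the compression solves `K'⁻¹ = z⁻¹ + η(R z)`.
  refine ⟨K, fun z => z * Ring.inverse (1 - -(η (R z) * z)), R, hK.mono hsub, ?_, hR.mono hsub,
    K0, by simp, ?_⟩
  · intro z hzb
    have hd : DifferentiableWithinAt ℂ (fun z => 1 - -(η (R z) * z))
        (Metric.ball 0 (1 / (100 * M ^ 4))) z :=
      (differentiableWithinAt_const _).sub
        ((η.differentiableAt.comp_differentiableWithinAt z ((hR.mono hsub) z hzb)).mul
          differentiableWithinAt_id).neg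
    have hinv : DifferentiableWithinAt ℂ (Ring.inverse ∘ fun z => 1 - -(η (R z) * z))
        (Metric.ball 0 (1 / (100 * M ^ 4))) z :=
      (differentiableAt_inverse (isUnit_one_sub_of_norm_lt_one
        (hunit z hzb))).comp_differentiableWithinAt z hd
    exact differentiableWithinAt_id.mul hinv
  · intro z hzb
    obtain ⟨p1, p2, p3, p4, p5, p6, p7, p8⟩ := hz z (hsub hzb)
    beta_reduce
    have i1 := inverse_one_sub_mul (hunit z hzb)
    have n1 := norm_inverse_one_sub_le (t := -(η (R z) * z)) h.norm_one_right
      (by rw [norm_neg]; exact hηR z hzb)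
    have hu1 := isUnit_one_sub_of_norm_lt_one (hunit z hzb)
    set D := Ring.inverse (1 - -(η (R z) * z))
    rw [sub_neg_eq_add] at i1 hu1
    have hw' : z * D * (1 + η (R z) * z) = z := by rw [mul_assoc, i1, mul_one]
    have n2 : ‖ι (z * D)‖ ≤ 1 / (100 * M ^ 4) * 2 := by
      refine (h.norm_incl _).trans ((norm_mul_le _ _).trans ?_)
      rw [mem_ball_zero_iff] at hzb
      gcongr
    have nb : M * M * M * (1 / (100 * M ^ 4) * 2) < 1 := by
      calc _ = 1 / (50 * M) := by field_simp; norm_num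
        _ < 1 := by
          rw [div_lt_one (by positivity)]
          linarith
    have n3 : ‖W * X * V * ι (z * D)‖ < 1 := by
      refine lt_of_le_of_lt ((norm_mul_le _ _).trans (mul_le_mul ((norm_mul_le _ _).trans
        (mul_le_mul ((norm_mul_le _ _).trans (mul_le_mul hc.norm_right h.norm_le (norm_nonneg _)
          hM.le)) hc.norm_left (norm_nonneg _) (by positivity))) n2 (norm_nonneg _)
          (by positivity))) nb
    have n4 : ‖V * ι (z * D) * W * X‖ < 1 := by
      refine lt_of_le_of_lt ((norm_mul_le _ _).trans (mul_le_mul ((norm_mul_le _ _).trans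
        (mul_le_mul ((norm_mul_le _ _).trans (mul_le_mul hc.norm_left n2 (norm_nonneg _)
          hM.le)) hc.norm_right (norm_nonneg _) (by positivity))) h.norm_le (norm_nonneg _)
          (by positivity))) (lt_of_eq_of_lt ?_ nb)
      ring
    have hG := p2
    rw [h.cauchyMap_eq (by linarith)] at hG
    refine ⟨((h.norm_mul_incl _).trans p1).trans_lt (by norm_num), p2, n3, ?_, ?_, ?_, hu1, hw'⟩
    · exact exp_compress_resolvent h hc hS hιS hXS hιT hVT hWT hfree (by simpa using hzb) p1 p2 p3
        p5 p7 p8 hw' n3 n4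
    · rw [p6, ← sub_neg_eq_add]
      exact isUnit_one_sub_of_norm_lt_one (by rw [norm_neg]; linarith)
    · rw [p6, hG]

end Banach

/-! ### Alternating words and their closed spans. -/

section Words

variable {A B : Type*} [CStarAlgebra A] [CStarAlgebra B] {κ : Type*}

/-- Non-empty alternating products of centred elements of the subalgebras `S i`, indexed by the
label of their first factor. -/
inductive AlternatingWord (E : A →ₗ[ℂ] B) (S : κ → Subalgebra ℂ A) : κ → A → Prop
  | single {i : κ} {a : A} (ha : a ∈ S i) (hE : E a = 0) : AlternatingWord E S i a
  | cons {i j : κ} {a b : A} (ha : a ∈ S i) (hE : E a = 0) (hij : i ≠ j)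
      (hb : AlternatingWord E S j b) : AlternatingWord E S i (a * b)

theorem AlternatingWord.exists_ofFn {E : A →ₗ[ℂ] B} {S : κ → Subalgebra ℂ A} {i : κ} {a : A}
    (h : AlternatingWord E S i a) :
    ∃ (k : ℕ) (p : Fin (k + 1) → κ) (f : Fin (k + 1) → A), p 0 = i ∧
      (∀ j, f j ∈ S (p j)) ∧ (∀ j, E (f j) = 0) ∧ (∀ j : Fin k, p j.castSucc ≠ p j.succ) ∧
      (List.ofFn f).prod = a := by
  induction h with
  | @single i a ha hE =>
    exact ⟨0, fun _ => i, fun _ => a, rfl, fun _ => ha, fun _ => hE, fun j => j.elim0, by simp⟩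
  | @cons i j a b ha hE hij _ ih =>
    obtain ⟨k, p, f, h0, h1, h2, h3, h4⟩ := ih
    refine ⟨k + 1, Fin.cons i p, Fin.cons a f, rfl, ?_, ?_, ?_, ?_⟩
    · exact Fin.cases (by simpa using ha) (by simpa using h1)
    · exact Fin.cases (by simpa using hE) (by simpa using h2)
    · refine Fin.cases ?_ fun m => ?_
      · simpa [h0] using hij
      · have := h3 m
        rw [← Fin.succ_castSucc]
        simpa only [Fin.cons_succ] using this
    · rw [List.ofFn_succ, List.prod_cons]
      simp only [Fin.cons_zero, Fin.cons_succ]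
      rw [h4]

theorem FreelyIndependent.apply_word {E : A →ₗ[ℂ] B} {S : κ → Subalgebra ℂ A}
    [PartialOrder A] [StarOrderedRing A] [PartialOrder B] [StarOrderedRing B]
    (h : FreelyIndependent E S) {i : κ} {a : A} (ha : AlternatingWord E S i a) : E a = 0 := by
  obtain ⟨k, p, f, -, h1, h2, h3, rfl⟩ := ha.exists_ofFn
  exact h k p f h1 h2 h3

/-- The closed linear span of the alternating words with a given label of the first factor. -/
def wordSpan (E : A →ₗ[ℂ] B) (S : κ → Subalgebra ℂ A) (i : κ) : Submodule ℂ A :=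
  (Submodule.span ℂ {a | AlternatingWord E S i a}).topologicalClosure

theorem FreelyIndependent.apply_wordSpan {E : A →ₗ[ℂ] B} {S : κ → Subalgebra ℂ A}
    [PartialOrder A] [StarOrderedRing A] [PartialOrder B] [StarOrderedRing B]
    (h : FreelyIndependent E S) (hE : Continuous E) {i : κ} {a : A} (ha : a ∈ wordSpan E S i) :
    E a = 0 := by
  have hle : Submodule.span ℂ {a | AlternatingWord E S i a} ≤ LinearMap.ker E :=
    Submodule.span_le.mpr fun a ha => h.apply_word ha
  exact Submodule.topologicalClosure_minimal _ hle (isClosed_singleton.preimage hE) ha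

theorem continuous_starAlgHom (ι : B →⋆ₐ[ℂ] A) : Continuous ι :=
  AddMonoidHomClass.continuous_of_bound ι 1
    (by simpa using NonUnitalStarAlgHom.norm_apply_le (ι : B →⋆ₙₐ[ℂ] A))

/-- Centred elements of the closure of a subalgebra are limits of centred elements. -/
theorem mem_closure_centred {ι : B →⋆ₐ[ℂ] A} {E : A →ₗ[ℂ] B} (hE : Continuous E)
    (hι : ∀ b, E (ι b) = b) {S : Subalgebra ℂ A} (hS : ∀ b, ι b ∈ S) {a : A}
    (ha : a ∈ S.topologicalClosure) (h0 : E a = 0) : a ∈ closure {c | c ∈ S ∧ E c = 0} := by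
  have hc : Continuous fun c => c - ι (E c) := continuous_id.sub ((continuous_starAlgHom ι).comp hE)
  have h := map_mem_closure (t := {c | c ∈ S ∧ E c = 0}) hc
    (show a ∈ closure (S : Set A) from ha)
    (fun c hc => ⟨S.sub_mem hc (hS _), by rw [map_sub, hι, sub_self]⟩)
  simpa [h0] using h

theorem mem_wordSpan {ι : B →⋆ₐ[ℂ] A} {E : A →ₗ[ℂ] B} (hE : Continuous E)
    (hι : ∀ b, E (ι b) = b) {S : κ → Subalgebra ℂ A} {i : κ} (hS : ∀ b, ι b ∈ S i) {a : A}
    (ha : a ∈ (S i).topologicalClosure) (h0 : E a = 0) : a ∈ wordSpan E S i :=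
  closure_mono (fun _ hc => Submodule.subset_span (.single hc.1 hc.2))
    (mem_closure_centred hE hι hS ha h0)

/-- Lets words with letters in the closures be built from the right, one letter at a time; it rests
on joint continuity of multiplication. -/
theorem mul_mem_wordSpan {ι : B →⋆ₐ[ℂ] A} {E : A →ₗ[ℂ] B} (hE : Continuous E)
    (hι : ∀ b, E (ι b) = b) {S : κ → Subalgebra ℂ A} {i j : κ} (hij : i ≠ j)
    (hS : ∀ b, ι b ∈ S i) {a b : A} (ha : a ∈ (S i).topologicalClosure) (h0 : E a = 0)
    (hb : b ∈ wordSpan E S j) : a * b ∈ wordSpan E S i := by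
  refine map_mem_closure₂ continuous_mul (mem_closure_centred hE hι hS ha h0) hb ?_
  rintro c ⟨hc, hc0⟩ d hd
  induction hd using Submodule.span_induction with
  | mem d hd => exact Submodule.subset_span (.cons hc hc0 hij hd)
  | zero => simp
  | add d e _ _ hd he => rw [mul_add]; exact Submodule.add_mem _ hd he
  | smul r d _ hd => rw [mul_smul_comm]; exact Submodule.smul_mem _ r hd

end Words

/-! ### Bounds and Cauchy-Schwarz for positive maps. -/

section PositiveMaps

variable {A B : Type*} [CStarAlgebra A] [PartialOrder A] [StarOrderedRing A]
  [CStarAlgebra B] [PartialOrder B] [StarOrderedRing B]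

/-- A decomposition into four positive parts gives the crude factor `4`, which suffices because it
is the same at every matrix level. -/
theorem norm_apply_le_of_nonneg_map (f : A →ₗ[ℂ] B) (hf : ∀ a, 0 ≤ a → 0 ≤ f a) (a : A) :
    ‖f a‖ ≤ 4 * ‖f 1‖ * ‖a‖ := by
  obtain ⟨y, hy0, hy, hsum⟩ := CStarAlgebra.exists_sum_four_nonneg a
  let g : A →ₚ[ℂ] B := PositiveLinearMap.mk₀ f hf
  have hg : ∀ x, g x = f x := fun _ => rfl
  have h1 : ∀ i, ‖f (y i)‖ ≤ ‖f 1‖ * ‖a‖ := fun i =>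
    (g.norm_apply_le_of_nonneg _ (hy0 i)).trans
      (mul_le_mul_of_nonneg_left (hy i) (norm_nonneg _))
  calc ‖f a‖ = ‖∑ i : Fin 4, Complex.I ^ (i : ℕ) • f (y i)‖ := by
        conv_lhs => rw [hsum]
        simp only [map_sum, map_smul]
    _ ≤ ∑ i : Fin 4, ‖f 1‖ * ‖a‖ := by
        refine (norm_sum_le _ _).trans (Finset.sum_le_sum fun i _ => ?_)
        rw [norm_smul, norm_pow, Complex.norm_I, one_pow, one_mul]
        exact h1 i
    _ = 4 * ‖f 1‖ * ‖a‖ := by simp; ring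

theorem norm_one_le (A : Type*) [CStarAlgebra A] : ‖(1 : A)‖ ≤ 1 := by
  rcases subsingleton_or_nontrivial A with h | h
  · rw [Subsingleton.elim (1 : A) 0, norm_zero]
    exact zero_le_one
  · exact CStarRing.norm_one.le

/-- An element `a` is `0` if `t a + p ≥ 0` for all real `t`. -/
theorem eq_zero_of_forall_nonneg {a p : B} (h : ∀ t : ℝ, 0 ≤ t • a + p) : a = 0 := by
  have hle : ∀ t : ℝ, 0 < t → ‖a‖ ≤ t⁻¹ * (2 * ‖p‖) := by
    intro t ht
    have h1 := h t
    have h2 := h (-t)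
    -- The positive elements `t a + p` and `-t a + p` add up to `2 p`, so each is dominated by it.
    have h3 : ‖t • a + p‖ ≤ ‖(2 : ℝ) • p‖ := by
      refine CStarAlgebra.norm_le_norm_of_nonneg_of_le h1 ?_
      have : (2 : ℝ) • p - (t • a + p) = (-t) • a + p := by rw [two_smul, neg_smul]; abel
      rw [← sub_nonneg, this]
      exact h2
    have h3' : ‖(-t) • a + p‖ ≤ ‖(2 : ℝ) • p‖ := by
      refine CStarAlgebra.norm_le_norm_of_nonneg_of_le h2 ?_
      have : (2 : ℝ) • p - ((-t) • a + p) = t • a + p := by rw [two_smul, neg_smul]; abel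
      rw [← sub_nonneg, this]
      exact h1
    have h4 : ‖(2 * t) • a‖ ≤ ‖t • a + p‖ + ‖(-t) • a + p‖ := by
      refine le_trans (le_of_eq ?_) (norm_sub_le _ _)
      congr 1
      rw [two_mul, add_smul, neg_smul]
      abel
    rw [norm_smul, Real.norm_of_nonneg (by positivity)] at h4
    rw [norm_smul, Real.norm_of_nonneg (by norm_num : (0 : ℝ) ≤ 2)] at h3 h3'
    rw [inv_mul_eq_div, le_div_iff₀ ht]
    linarith
  have hlim : Filter.Tendsto (fun t : ℝ => t⁻¹ * (2 * ‖p‖)) Filter.atTop (nhds (0 * (2 * ‖p‖))) :=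
    tendsto_inv_atTop_zero.mul_const _
  rw [zero_mul] at hlim
  have := ge_of_tendsto hlim (Filter.eventually_atTop.mpr ⟨1, fun t ht => hle t (by linarith)⟩)
  exact norm_le_zero_iff.mp this

theorem apply_star_of_nonneg_map (f : A →ₗ[ℂ] B) (hf : ∀ a, 0 ≤ a → 0 ≤ f a) (a : A) :
    f (star a) = star (f a) := by
  let g : A →ₚ[ℂ] B := PositiveLinearMap.mk₀ f hf
  exact map_star g a

/-- The degenerate case of the Cauchy-Schwarz inequality for positive maps. -/
theorem apply_mul_eq_zero_of_nonneg_map (f : A →ₗ[ℂ] B) (hf : ∀ a, 0 ≤ a → 0 ≤ f a) {c : A}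
    (hc : f (c * star c) = 0) (d : A) : f (c * d) = 0 := by
  -- In `f((t c + e*)(t c + e*)*) ≥ 0` the quadratic term in `t` vanishes, and an expression affine
  -- in `t` can stay positive only if its slope is zero. Taking `e = d` and `e = i d` kills both
  -- parts of `f(c d)`.
  have hre : ∀ e : A, f (c * e) + star (f (c * e)) = 0 := by
    intro e
    refine eq_zero_of_forall_nonneg (p := f (star e * e)) fun t => ?_
    · have h1 := hf _ (mul_star_self_nonneg (t • c + star e))
      refine h1.trans_eq ?_
      have h2 : (t • c + star e) * star (t • c + star e) =
          (t * t) • (c * star c) + (t • (c * e) + t • star (c * e)) + star e * e := by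
        simp only [star_add, star_smul, star_star, star_trivial, star_mul, add_mul, mul_add,
          smul_mul_assoc, mul_smul_comm, smul_add, mul_smul]
        abel
      rw [h2, map_add, map_add, map_add, ← apply_star_of_nonneg_map f hf, smul_add]
      simp only [← Complex.coe_smul, map_smul, hc, smul_zero, zero_add]
  have h1 := hre d
  have h2 := hre (Complex.I • d)
  set x := f (c * d)
  rw [mul_smul_comm, map_smul, star_smul, Complex.star_def, Complex.conj_I, neg_smul,
    ← sub_eq_add_neg, ← smul_sub, smul_eq_zero_iff_right Complex.I_ne_zero, sub_eq_zero] at h2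
  change x + star x = 0 at h1
  rw [← h2, ← two_smul ℂ, smul_eq_zero_iff_right two_ne_zero] at h1
  exact h1

end PositiveMaps

/-! ### Entrywise amplification to matrices. -/

section Amplification

variable {A B : Type*} [CStarAlgebra A] [CStarAlgebra B] (n : ℕ)

theorem amp_mul_apply (a : A) (M : CStarMatrix (Fin n) (Fin n) A) (i j : Fin n) :
    (amp n a * M) i j = a * M i j :=
  Matrix.diagonal_mul (fun _ => a) M i j

theorem mul_amp_apply (a : A) (M : CStarMatrix (Fin n) (Fin n) A) (i j : Fin n) :
    (M * amp n a) i j = M i j * a :=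
  Matrix.mul_diagonal (fun _ => a) M i j

theorem star_amp (a : A) : star (amp n a) = amp n (star a) :=
  Matrix.diagonal_conjTranspose (fun _ : Fin n => a)

theorem amp_apply_mem {S : Subalgebra ℂ A} {a : A} (ha : a ∈ S) (i j : Fin n) :
    amp n a i j ∈ S := by
  change Matrix.diagonal (fun _ => a) i j ∈ S
  rw [Matrix.diagonal_apply]
  split_ifs
  exacts [ha, S.zero_mem]

theorem map_one_eq_amp (f : A →ₗ[ℂ] B) :
    (1 : CStarMatrix (Fin n) (Fin n) A).map f = amp n (f 1) := by
  ext i j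
  change f ((1 : Matrix (Fin n) (Fin n) A) i j) = Matrix.diagonal (fun _ => f 1) i j
  rw [Matrix.one_apply, Matrix.diagonal_apply]
  split_ifs
  exacts [rfl, map_zero f]

theorem amp_mul (a b : A) : amp n (a * b) = amp n a * amp n b :=
  (Matrix.diagonal_mul_diagonal (fun _ : Fin n => a) fun _ => b).symm

/-- The scalar amplification as a `*`-homomorphism. -/
def ampHom : A →⋆ₙₐ[ℂ] CStarMatrix (Fin n) (Fin n) A where
  toFun := amp n
  map_smul' r a := Matrix.diagonal_smul r fun _ : Fin n => a
  map_zero' := Matrix.diagonal_zero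
  map_add' a b := (Matrix.diagonal_add (fun _ : Fin n => a) fun _ => b).symm
  map_mul' a b := amp_mul n a b
  map_star' a := (star_amp n a).symm

theorem compress_apply (E : A →ₗ[ℂ] B) (V T : A) : compress E V T = E (V * T * star V) := by
  simp [compress, mul_assoc]

variable [PartialOrder A] [StarOrderedRing A] [PartialOrder B] [StarOrderedRing B]

theorem norm_amp_le (a : A) : ‖amp n a‖ ≤ ‖a‖ :=
  NonUnitalStarAlgHom.norm_apply_le (ampHom n) a

/-- Entrywise application of a unital `*`-homomorphism to matrices. -/
def inclMatrix (ι : B →⋆ₐ[ℂ] A) :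
    CStarMatrix (Fin n) (Fin n) B →ₐ[ℂ] CStarMatrix (Fin n) (Fin n) A :=
  { RingHom.mapMatrix (m := Fin n) (ι : B →+* A) with
    toFun := fun M => M.map ι
    commutes' := fun r => by
      ext i j
      change ι ((algebraMap ℂ (Matrix (Fin n) (Fin n) B) r) i j) =
        (algebraMap ℂ (Matrix (Fin n) (Fin n) A) r) i j
      rw [Matrix.algebraMap_matrix_apply, Matrix.algebraMap_matrix_apply]
      split_ifs
      exacts [AlgHomClass.commutes ι r, map_zero ι] }

theorem norm_inclMatrix_le (ι : B →⋆ₐ[ℂ] A) (M : CStarMatrix (Fin n) (Fin n) B) :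
    ‖inclMatrix n ι M‖ ≤ ‖M‖ :=
  NonUnitalStarAlgHom.norm_apply_le (CStarMatrix.mapₙₐ (n := Fin n) (ι : B →⋆ₙₐ[ℂ] A)) M

theorem norm_map_le (ψ : CompletelyPositiveMap A B) (M : CStarMatrix (Fin n) (Fin n) A) :
    ‖M.map ψ.toLinearMap‖ ≤ 4 * ‖ψ.toLinearMap 1‖ * ‖M‖ := by
  have h := norm_apply_le_of_nonneg_map
    (CStarMatrix.mapₗ ψ.toLinearMap : CStarMatrix (Fin n) (Fin n) A →ₗ[ℂ] _)
    (ψ.map_cstarMatrix_nonneg' n) M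
  refine h.trans ?_
  gcongr
  rw [CStarMatrix.mapₗ_apply, map_one_eq_amp]
  exact norm_amp_le n _

/-- Entrywise application of a linear map with a given bound, as a bounded map of matrices. -/
def mapMatrixL (f : A →ₗ[ℂ] B) (C : ℝ)
    (hC : ∀ M : CStarMatrix (Fin n) (Fin n) A, ‖M.map f‖ ≤ C * ‖M‖) :
    CStarMatrix (Fin n) (Fin n) A →L[ℂ] CStarMatrix (Fin n) (Fin n) B :=
  LinearMap.mkContinuous (CStarMatrix.mapₗ f) C hC

end Amplification

/-! ### The compressed conditional expectation. -/

section Compress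

variable {A B : Type*} [CStarAlgebra A] [PartialOrder A] [StarOrderedRing A]
  [CStarAlgebra B] [PartialOrder B] [StarOrderedRing B]

theorem IsCompletelyPositive.map_nonneg {φ : A →ₗ[ℂ] B} (h : IsCompletelyPositive φ) {a : A}
    (ha : 0 ≤ a) : 0 ≤ φ a := by
  obtain ⟨ψ, rfl⟩ := h
  have h : ψ 0 ≤ ψ a := OrderHomClass.mono ψ ha
  rwa [map_zero ψ] at h

theorem IsCompletelyPositive.continuous {φ : A →ₗ[ℂ] B} (h : IsCompletelyPositive φ) :
    Continuous φ := by
  obtain ⟨ψ, rfl⟩ := h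
  exact map_continuous ψ

theorem isCompletelyPositive_compress {E : A →ₗ[ℂ] B} (hE : IsCompletelyPositive E) (V : A) :
    IsCompletelyPositive (compress E V) := by
  obtain ⟨ψ, rfl⟩ := hE
  refine ⟨⟨compress ψ.toLinearMap V, fun k M hM => ?_⟩, rfl⟩
  have h := ψ.map_cstarMatrix_nonneg' k _ (star_right_conjugate_nonneg hM (amp k V))
  have he : M.map (compress ψ.toLinearMap V) =
      (amp k V * M * star (amp k V)).map ψ.toLinearMap := by
    ext i j
    rw [CStarMatrix.map_apply, CStarMatrix.map_apply, compress_apply, star_amp, mul_amp_apply,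
      amp_mul_apply]
  rw [he]
  exact h

/-- A compression that restricts to the identity of `B` is a conditional expectation: `V` commutes
with `B` modulo the kernel of `E`. -/
theorem isConditionalExpectation_compress {ι : B →⋆ₐ[ℂ] A} {E : A →ₗ[ℂ] B}
    (hE : IsConditionalExpectation ι E) {V : A} (hEV : ∀ b, E (V * ι b * star V) = b) :
    IsConditionalExpectation ι (compress E V) := by
  have hpos : ∀ a, 0 ≤ a → 0 ≤ E a := fun a ha => hE.completelyPositive.map_nonneg ha
  have hl (b : B) (a : A) : E (ι b * a) = b * E a := by
    simpa using hE.bimodule b 1 a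
  have hr (a : A) (b : B) : E (a * ι b) = E a * b := by
    simpa using hE.bimodule 1 b a
  have hVV : E (V * star V) = 1 := by simpa using hEV 1
  have hzero (b : B) (d : A) : E (V * ι b * d) = b * E (V * d) := by
    -- All four terms of `E[c c*]` equal `b b*` up to sign, and they cancel.
    have h := apply_mul_eq_zero_of_nonneg_map E hpos (c := V * ι b - ι b * V) ?_ d
    · rw [sub_mul, map_sub, sub_eq_zero] at h
      rw [h, mul_assoc, hl]
    · have e : (V * ι b - ι b * V) * star (V * ι b - ι b * V) =
          V * ι (b * star b) * star V - V * ι b * star V * ι (star b)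
            - ι b * (V * ι (star b) * star V) + ι b * (V * star V * ι (star b)) := by
        simp only [star_sub, star_mul, map_mul, map_star]
        noncomm_ring
      rw [e, map_add, map_sub, map_sub, hEV, hr, hEV, hl, hEV, hl, hr, hVV]
      simp
  have hstar : ∀ a, E (star a) = star (E a) := apply_star_of_nonneg_map E hpos
  have hzero' (b : B) (d : A) : E (d * ι b * star V) = E (d * star V) * b := by
    have h := congrArg star (hzero (star b) (star d))
    rw [← hstar, star_mul (star b), ← hstar] at h
    simpa [mul_assoc, ← map_star] using h
  refine ⟨fun b => by rw [compress_apply, hEV], fun b₁ b₂ a => ?_,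
    isCompletelyPositive_compress hE.completelyPositive V⟩
  rw [compress_apply, compress_apply]
  have e : V * (ι b₁ * a * ι b₂) * star V = V * ι b₁ * a * ι b₂ * star V := by
    simp only [mul_assoc]
  rw [e, hzero', mul_assoc (V * ι b₁), hzero, mul_assoc V]

end Compress

/-! ### Freeness at the matrix levels. -/

section MatrixWords

variable {A B : Type*} [CStarAlgebra A] [CStarAlgebra B] {n : ℕ}

/-- The subalgebra of matrices with entries in a subalgebra. -/
def matrixSubalgebra (n : ℕ) (S : Subalgebra ℂ A) : Subalgebra ℂ (CStarMatrix (Fin n) (Fin n) A) :=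
  S.matrix (n := Fin n)

theorem isClosed_matrixSubalgebra {S : Subalgebra ℂ A} (hS : IsClosed (S : Set A)) :
    IsClosed (matrixSubalgebra n S : Set (CStarMatrix (Fin n) (Fin n) A)) := by
  have h : (matrixSubalgebra n S : Set (CStarMatrix (Fin n) (Fin n) A)) =
      ⋂ i, ⋂ j, (fun M : Matrix (Fin n) (Fin n) A => M i j) ⁻¹' (S : Set A) := Set.ext fun M =>
    ⟨fun h => Set.mem_iInter.2 fun i => Set.mem_iInter.2 fun j => h i j,
      fun h i j => Set.mem_iInter.1 (Set.mem_iInter.1 h i) j⟩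
  rw [h]
  exact isClosed_iInter fun i => isClosed_iInter fun j =>
    hS.preimage ((continuous_apply j).comp (continuous_apply i))

variable [PartialOrder A] [StarOrderedRing A] [PartialOrder B] [StarOrderedRing B]

theorem alternatingWordsVanish_matrix {ι : B →⋆ₐ[ℂ] A} {E : A →ₗ[ℂ] B}
    (hE : IsConditionalExpectation ι E) {S : Fin 2 → Subalgebra ℂ A}
    (hS : ∀ i b, ι b ∈ S i) (hfree : FreelyIndependent E S) {C : ℝ}
    (hC : ∀ M : CStarMatrix (Fin n) (Fin n) A, ‖M.map E‖ ≤ C * ‖M‖)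
    {a u : CStarMatrix (Fin n) (Fin n) A}
    (ha : a ∈ matrixSubalgebra n (S 0).topologicalClosure) (ha0 : a.map E = 0)
    (hu : u ∈ matrixSubalgebra n (S 1).topologicalClosure) (hu0 : u.map E = 0) :
    AlternatingWordsVanish (mapMatrixL n E C hC) a u := by
  have hc := hE.completelyPositive.continuous
  -- An entry of `p * q` is a sum of products of a centred letter with a limit of combinations of
  -- words starting in the other algebra.
  have hmul {i j : Fin 2} (hij : i ≠ j) {p q : CStarMatrix (Fin n) (Fin n) A}
      (hp : p ∈ matrixSubalgebra n (S i).topologicalClosure) (hp0 : p.map E = 0)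
      (hq : ∀ k l, q k l ∈ wordSpan E S j) (k l : Fin n) : (p * q) k l ∈ wordSpan E S i := by
    rw [CStarMatrix.mul_apply]
    exact Submodule.sum_mem _ fun m _ => mul_mem_wordSpan hc hE.apply_incl hij (hS i) (hp k m)
      (congrFun (congrFun hp0 k) m) (hq m l)
  have hsingle {i : Fin 2} {p : CStarMatrix (Fin n) (Fin n) A}
      (hp : p ∈ matrixSubalgebra n (S i).topologicalClosure) (hp0 : p.map E = 0) (k l : Fin n) :
      p k l ∈ wordSpan E S i :=
    mem_wordSpan hc hE.apply_incl (hS i) (hp k l) (congrFun (congrFun hp0 k) l)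
  have hvanish {i : Fin 2} {p : CStarMatrix (Fin n) (Fin n) A}
      (hp : ∀ k l, p k l ∈ wordSpan E S i) : mapMatrixL n E C hC p = 0 := by
    ext k l
    exact hfree.apply_wordSpan hc (hp k l)
  have h1 (m : ℕ) : ∀ k l, (u * (a * u) ^ m) k l ∈ wordSpan E S 1 := by
    induction m with
    | zero => rw [pow_zero, mul_one]; exact hsingle hu hu0
    | succ m ih =>
      rw [pow_succ', mul_assoc a]
      exact hmul one_ne_zero hu hu0 (hmul zero_ne_one ha ha0 ih)
  have h2 (m : ℕ) : ∀ k l, ((a * u) ^ m * a) k l ∈ wordSpan E S 0 := by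
    induction m with
    | zero => rw [pow_zero, one_mul]; exact hsingle ha ha0
    | succ m ih =>
      rw [pow_succ', mul_assoc, mul_assoc a]
      exact hmul zero_ne_one ha ha0 (hmul one_ne_zero hu hu0 ih)
  intro m
  refine ⟨hvanish (i := 0) ?_, hvanish (h1 m), hvanish (h2 m), hvanish (i := 1) ?_⟩
  · rw [pow_succ', mul_assoc]
    exact hmul zero_ne_one ha ha0 (h1 m)
  · rw [mul_assoc]
    exact hmul one_ne_zero hu hu0 (h2 m)

end MatrixWords

section Generators

variable {A B : Type*} [CStarAlgebra A] [CStarAlgebra B]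

theorem incl_mem_generatedBy (ι : B →⋆ₐ[ℂ] A) (a : A) (b : B) : ι b ∈ generatedBy ι a :=
  StarAlgebra.subset_adjoin ℂ _ (Or.inl ⟨b, rfl⟩)

theorem self_mem_generatedBy (ι : B →⋆ₐ[ℂ] A) (a : A) : a ∈ generatedBy ι a :=
  StarAlgebra.subset_adjoin ℂ _ (Or.inr rfl)

theorem star_mem_generatedBy (ι : B →⋆ₐ[ℂ] A) (a : A) : star a ∈ generatedBy ι a :=
  show star a ∈ StarAlgebra.adjoin ℂ (Set.range ι ∪ {a}) from
    star_mem (StarAlgebra.subset_adjoin ℂ _ (Or.inr rfl))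

end Generators

/-! ### The free convolution power. -/

section Power

variable {A B : Type*} [CStarAlgebra A] [PartialOrder A] [StarOrderedRing A]
  [CStarAlgebra B] [PartialOrder B] [StarOrderedRing B]

theorem IsConditionalExpectation.norm_map_le {ι : B →⋆ₐ[ℂ] A} {E : A →ₗ[ℂ] B}
    (hE : IsConditionalExpectation ι E) (n : ℕ) (M : CStarMatrix (Fin n) (Fin n) A) :
    ‖M.map E‖ ≤ 4 * ‖M‖ := by
  have h1 : E 1 = 1 := by simpa using hE.apply_incl 1
  obtain ⟨ψ, hψ⟩ := hE.completelyPositive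
  have h := OperatorValued.norm_map_le n ψ M
  rw [hψ, h1] at h
  refine h.trans ?_
  have := norm_one_le B
  gcongr
  linarith

/-- Complete positivity of `η - id` serves here to bound `η` uniformly in the matrix level. -/
theorem norm_map_le_of_sub_id {η : B →ₗ[ℂ] B} (hη : IsCompletelyPositive (η - LinearMap.id))
    (n : ℕ) (M : CStarMatrix (Fin n) (Fin n) B) :
    ‖M.map η‖ ≤ (4 * ‖η 1 - 1‖ + 1) * ‖M‖ := by
  obtain ⟨ψ, hψ⟩ := hη
  have h := norm_map_le n ψ M
  rw [hψ, LinearMap.sub_apply, LinearMap.id_apply] at h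
  have e : M.map η = M.map (η - LinearMap.id : B →ₗ[ℂ] B) + M := by
    ext i j
    simp
  rw [e, add_mul, one_mul]
  exact (norm_add_le _ _).trans (by gcongr)

theorem isBoundedExpectation_matrix {ι : B →⋆ₐ[ℂ] A} {E : A →ₗ[ℂ] B}
    (hE : IsConditionalExpectation ι E) {X : A} {C : ℝ} (hC : 4 ≤ C) (hX : ‖X‖ ≤ C) (n : ℕ) :
    IsBoundedExpectation (inclMatrix n ι) (mapMatrixL n E 4 (hE.norm_map_le n)) (amp n X) C where
  one_le := by linarith
  norm_one_left := norm_one_le _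
  norm_one_right := norm_one_le _
  norm_incl := norm_inclMatrix_le n ι
  norm_exp M := (hE.norm_map_le n M).trans (by gcongr)
  norm_le := (norm_amp_le n X).trans hX
  apply_incl b := by
    ext i j
    exact hE.apply_incl _
  map_incl_mul b a := by
    ext i j
    change E (∑ k, ι (b i k) * a k j) = ∑ k, b i k * E (a k j)
    rw [map_sum]
    exact Finset.sum_congr rfl fun k _ => by simpa using hE.bimodule (b i k) 1 (a k j)
  map_mul_incl a b := by
    ext i j
    change E (∑ k, a i k * ι (b k j)) = ∑ k, E (a i k) * b k j
    rw [map_sum]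
    exact Finset.sum_congr rfl fun k _ => by simpa using hE.bimodule 1 (b k j) (a i k)

theorem isCompressor_matrix {ι : B →⋆ₐ[ℂ] A} {E : A →ₗ[ℂ] B}
    (hE : IsConditionalExpectation ι E) {η : B →ₗ[ℂ] B} {D C : ℝ} {n : ℕ}
    (hD : ∀ M : CStarMatrix (Fin n) (Fin n) B, ‖M.map η‖ ≤ D * ‖M‖) (hDC : D ≤ C) {V : A}
    (hVC : ‖V‖ ≤ C)
    (hV : ∀ b₁ b₂ : B, V * ι b₁ * star V * ι b₂ * V = V * ι b₁ * ι (η b₂))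
    (hEV : ∀ b : B, E (V * ι b * star V) = b) :
    IsCompressor (inclMatrix n ι) (mapMatrixL n E 4 (hE.norm_map_le n)) (mapMatrixL n η D hD)
      (amp n V) (amp n (star V)) C where
  norm_left := (norm_amp_le n V).trans hVC
  norm_right := (norm_amp_le n _).trans (by rwa [norm_star])
  norm_map M := (hD M).trans (by gcongr)
  sandwich b₁ b₂ := by
    ext i j
    rw [mul_amp_apply, CStarMatrix.mul_apply, CStarMatrix.mul_apply, Finset.sum_mul]
    refine Finset.sum_congr rfl fun k _ => ?_
    rw [mul_amp_apply, amp_mul_apply]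
    exact hV _ _
  exp_compress b := by
    ext i j
    change E ((amp n V * inclMatrix n ι b * amp n (star V)) i j) = b i j
    rw [mul_amp_apply, amp_mul_apply]
    exact hEV _

/-- If `K (1 + R z) = z` with `1 + R z` invertible, then `K⁻¹ = z⁻¹ + R`. -/
theorem isUnit_and_eq_inverse_sub_inverse {R : Type*} [Ring R] {k r z : R}
    (hu : IsUnit (1 + r * z)) (hk : k * (1 + r * z) = z) (hz : IsUnit z) :
    IsUnit k ∧ r = Ring.inverse k - Ring.inverse z := by
  obtain ⟨u, hu⟩ := hu
  obtain ⟨v, rfl⟩ := hz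
  rw [← hu, ← Units.eq_mul_inv_iff_mul_eq, ← Units.val_mul] at hk
  subst hk
  refine ⟨Units.isUnit _, ?_⟩
  rw [Ring.inverse_unit, Ring.inverse_unit, mul_inv_rev, inv_inv, Units.val_mul, hu, add_mul,
    one_mul, mul_assoc, Units.mul_inv, mul_one, add_sub_cancel_left]

theorem isFreeConvolutionPower_compress {ι : B →⋆ₐ[ℂ] A} {E : A →ₗ[ℂ] B}
    (hE : IsConditionalExpectation ι E) {η : B →ₗ[ℂ] B}
    (hη : IsCompletelyPositive (η - LinearMap.id)) {X V : A} (hfree : FreeOver ι E X V)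
    (hV : ∀ b₁ b₂ : B, V * ι b₁ * star V * ι b₂ * V = V * ι b₁ * ι (η b₂))
    (hEV : ∀ b : B, E (V * ι b * star V) = b) :
    IsFreeConvolutionPower η (law ι E X) (law ι (compress E V) (star V * X * V)) := by
  set D : ℝ := 4 * ‖η 1 - 1‖ + 1 with hD
  have hD0 : 0 ≤ D := by positivity
  -- One constant dominating the bounds of `E`, `X`, `V` and `η` at all levels, which makes the
  -- radius independent of `n`.
  set C : ℝ := 4 + ‖X‖ + ‖V‖ + D with hC
  have hX0 := norm_nonneg X
  have hV0 := norm_nonneg V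
  have key (n : ℕ) := by
    have h := isBoundedExpectation_matrix hE (X := X) (C := C) (by linarith) (by linarith) n
    have hc := isCompressor_matrix (C := C) hE (norm_map_le_of_sub_id hη n) (by linarith)
      (by linarith) hV hEV
    exact exists_rTransform_compress h hc
      (S := matrixSubalgebra n (generatedBy ι X).topologicalClosure)
      (T := matrixSubalgebra n (generatedBy ι V).topologicalClosure)
      (isClosed_matrixSubalgebra (Subalgebra.isClosed_topologicalClosure _))
      (fun b i j => Subalgebra.le_topologicalClosure _ (incl_mem_generatedBy ι X _))
      (amp_apply_mem n (Subalgebra.le_topologicalClosure _ (self_mem_generatedBy ι X)))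
      (fun b i j => Subalgebra.le_topologicalClosure _ (incl_mem_generatedBy ι V _))
      (amp_apply_mem n (Subalgebra.le_topologicalClosure _ (self_mem_generatedBy ι V)))
      (amp_apply_mem n (Subalgebra.le_topologicalClosure _ (star_mem_generatedBy ι V)))
      (fun a ha ha0 u hu hu0 => alternatingWordsVanish_matrix hE
        (S := ![generatedBy ι X, generatedBy ι V])
        (Fin.forall_fin_two.2 ⟨incl_mem_generatedBy ι X, incl_mem_generatedBy ι V⟩) hfree
        (hE.norm_map_le n) ha ha0 hu hu0)
  choose K K' R hK hK' hR hK0 hK0' hz using key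
  have hE' := isConditionalExpectation_compress hE hEV
  -- The second R-transform is taken to be `η` of the first; the content is that `K'` inverts the
  -- transform of the compressed law.
  refine ⟨1 / (100 * C ^ 4), by positivity, R, fun n z => (R n z).map η,
    ⟨hR, K, ⟨hK, hK0, fun n z hzb => ?_⟩, fun n z hzb hu => ?_⟩,
    ⟨fun n => ?_, K', ⟨hK', hK0', fun n z hzb => ?_⟩, fun n z hzb hu => ?_⟩, fun n z hzb => rfl⟩
  · obtain ⟨h1, h2, -⟩ := hz n z hzb
    have h := hasSum_gTerm_law ι E hE X n (K n z) h1
    convert h using 1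
    exact h2.symm
  · obtain ⟨-, -, -, -, h5, h6, -⟩ := hz n z hzb
    exact isUnit_and_eq_inverse_sub_inverse h5 h6 hu
  · exact (mapMatrixL n η D (norm_map_le_of_sub_id hη n)).differentiable.comp_differentiableOn
      (hR n)
  · obtain ⟨-, -, h3, h4, -⟩ := hz n z hzb
    rw [← amp_mul, ← amp_mul] at h3 h4
    have h := hasSum_gTerm_law ι (compress E V) hE' (star V * X * V) n (K' n z) h3
    convert h using 1
    conv_lhs => rw [← h4]
    ext i j
    rw [CStarMatrix.map_apply, compress_apply, ← amp_mul_apply, ← mul_amp_apply]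
    rfl
  · obtain ⟨-, -, -, -, -, -, h7, h8⟩ := hz n z hzb
    exact isUnit_and_eq_inverse_sub_inverse h7 h8 hu

end Power

end OperatorValued

end

theorem theorem3p1 {A B : Type*}
    [CStarAlgebra A] [PartialOrder A] [StarOrderedRing A]
    [CStarAlgebra B] [PartialOrder B] [StarOrderedRing B]
    (ι : B →⋆ₐ[ℂ] A) (E : A →ₗ[ℂ] B)
    (hE : OperatorValued.IsConditionalExpectation ι E)
    (η : B →ₗ[ℂ] B)
    (hη : OperatorValued.IsCompletelyPositive (η - LinearMap.id))
    (X V : A) (hX : IsSelfAdjoint X)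
    (hfree : OperatorValued.FreeOver ι E X V)
    (hV : ∀ b₁ b₂ : B, V * ι b₁ * star V * ι b₂ * V = V * ι b₁ * ι (η b₂))
    (hEV : ∀ b : B, E (V * ι b * star V) = b) :
    OperatorValued.IsConditionalExpectation ι (OperatorValued.compress E V) ∧
    OperatorValued.IsFreeConvolutionPower η
      (OperatorValued.law ι E X)
      (OperatorValued.law ι (OperatorValued.compress E V) (star V * X * V)) :=
  ⟨OperatorValued.isConditionalExpectation_compress hE hEV,
    OperatorValued.isFreeConvolutionPower_compress hE hη hfree hV hEV⟩
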